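/- Let $k,l\in\mathbb N_0$. A bilabelled graph $\mathbf K=(K,\mathbf a,\mathbf b)$ of type $(k,l)$ consists of a finite undirected graph $K$ (loops and multiple edges are allowed), a tuple $\mathbf a=(a_1,\dots,a_k)$ of input vertices and a tuple $\mathbf b=(b_1,\dots,b_l)$ of output vertices of $K$ (repetitions are allowed). Bilabelled graphs are considered up to isomorphism (preserving both tuples). Let $K^\circ$ be the graph obtained from $K$ by adding a cycle $\alpha_k,\dots,\alpha_1,\beta_1,\dots,\beta_l$ of new vertices together with the edges $a_i\alpha_i$ and $b_j\beta_j$ for all $i,j$, and let $K^\odot$ be obtained from $K^\circ$ by adding one more vertex adjacent to every vertex of that cycle. For a vertex $v$ of $K$ let $d_v$ be its degree in $K$ and $\tilde d_v$ its degree in $K^\circ$. Let $C(k,l)$ be the set of all bilabelled graphs $\mathbf K=(K,\mathbf a,\mathbf b)$ of type $(k,l)$ such that (i) $\mathbf K$ is planar, that is, $K^\odot$ is a planar graph; (ii) $\tilde d_v$ is even for every vertex $v$ of $K$; (iii) $K$ is bipartite, with a bipartition such that all the vertices $a_1,\dots,a_k,b_1,\dots,b_l$ lie in one of the two parts; (iv)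 there is no vertex $v$ with $d_v=\tilde d_v=2$; (v) $K$ has no multiple edges; (vi) every connected component of $K$ contains at least one of the vertices $a_1,\dots,a_k,b_1,\dots,b_l$. Then $C(k,l)$ is a finite set for every $k,l\in\mathbb N_0$. -/

import Mathlib

/-!
Graphs are Mathlib's multigraphs `Graph α β`: undirected, loops and multiple edges are allowed.
-/

/-- The degree of a vertex of a multigraph: the number of edge ends at it, so that a loop
counts twice. -/
noncomputable def Graph.deg {α β : Type*} (G : Graph α β) (v : α) : ℕ :=
  (G.incidenceSet v).ncard + (G.loopSet v).ncard

/-- The polygonal line in the plane through the corners `c 0, c 1, c 2, …`, parametrised so that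
it is at `c i` at time `i` and runs through the segment from `c i` to `c (i + 1)` affinely. -/
noncomputable def polyline (c : ℕ → ℝ × ℝ) (t : ℝ) : ℝ × ℝ :=
  AffineMap.lineMap (c ⌊t⌋₊) (c (⌊t⌋₊ + 1)) (t - ⌊t⌋₊)

/-- `I` is the interior (endpoints removed) of a polygonal arc from `p` to `q`, that is, of a
curve without self-intersections consisting of finitely many line segments. If `p = q`, it is
a simple closed polygon with the point `p` removed. -/
def IsPolygonalArcInterior (I : Set (ℝ × ℝ)) (p q : ℝ × ℝ) : Prop :=
  ∃ (N : ℕ) (c : ℕ → ℝ × ℝ), 0 < N ∧ c 0 = p ∧ c N = q ∧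
    Set.InjOn (polyline c) (Set.Ico 0 (N : ℝ)) ∧
    Set.InjOn (polyline c) (Set.Ioc 0 (N : ℝ)) ∧
    I = polyline c '' Set.Ioo 0 (N : ℝ)

/-- A multigraph is planar if it can be drawn in the plane: the vertices are distinct points, each
edge is a polygonal arc between its ends, and the interior of an edge contains neither a vertex
nor a point of another edge. -/
def Graph.IsPlanar {α β : Type*} (G : Graph α β) : Prop :=
  ∃ (pt : α → ℝ × ℝ) (I : β → Set (ℝ × ℝ)),
    Set.InjOn pt G.vertexSet ∧
    (∀ e x y, G.IsLink e x y → IsPolygonalArcInterior (I e) (pt x) (pt y)) ∧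
    (∀ e ∈ G.edgeSet, ∀ v ∈ G.vertexSet, pt v ∉ I e) ∧
    (∀ e ∈ G.edgeSet, ∀ f ∈ G.edgeSet, e ≠ f → Disjoint (I e) (I f))

/-- A bilabelled graph `(K, a, b)`: a finite multigraph `K` with a tuple `a` of `k` input vertices
and a tuple `b` of `l` output vertices. -/
structure BilabelledGraph (k l : ℕ) where
  α : Type
  β : Type
  graph : Graph α β
  finite_vertexSet : graph.vertexSet.Finite
  finite_edgeSet : graph.edgeSet.Finite
  input : Fin k → graph.vertexSet
  output : Fin l → graph.vertexSet

namespace BilabelledGraph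

variable {k l : ℕ}

/-- The cyclic word `a_k, …, a_1, b_1, …, b_l` of input and output vertices. -/
def boundary (K : BilabelledGraph k l) : Fin (k + l) → K.graph.vertexSet :=
  Fin.append (fun i : Fin k => K.input i.rev) K.output

/-- Incidence in `K°`. The vertex `Sum.inr i` is the `i`-th vertex of the enveloping cycle
`α_k, …, α_1, β_1, …, β_l`; its `i`-th string and its `i`-th cycle edge are
`Sum.inr (Sum.inl i)` and `Sum.inr (Sum.inr i)`. -/
def EnvLink (K : BilabelledGraph k l) :
    K.β ⊕ (Fin (k + l) ⊕ Fin (k + l)) → K.α ⊕ Fin (k + l) → K.α ⊕ Fin (k + l) → Prop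
  | .inl e, .inl x, .inl y => K.graph.IsLink e x y
  | .inl _, _, _ => False
  | .inr (.inl i), x, y => s(x, y) = s(.inl (K.boundary i : K.α), .inr i)
  | .inr (.inr i), x, y => s(x, y) = s(.inr i, .inr (finRotate (k + l) i))

/-- The graph `K°`: add to `K` the enveloping cycle `α_k, …, α_1, β_1, …, β_l` of new vertices,
and the edges `a_i α_i` and `b_j β_j`. -/
def envelope (K : BilabelledGraph k l) :
    Graph (K.α ⊕ Fin (k + l)) (K.β ⊕ (Fin (k + l) ⊕ Fin (k + l))) where
  vertexSet := {x | ∀ v, x = .inl v → v ∈ K.graph.vertexSet}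
  IsLink := K.EnvLink
  isLink_symm := by
    rintro (e | i | i) - <;> refine ⟨?_⟩
    · rintro (x | x) (y | y) h
      · exact Graph.IsLink.symm (G := K.graph) h
      all_goals exact h
    · intro x y h; exact Sym2.eq_swap.trans h
    · intro x y h; exact Sym2.eq_swap.trans h
  eq_or_eq_of_isLink_of_isLink := by
    rintro (e | i | i) x y v w h h'
    · rcases x with x | x <;> rcases y with y | y <;> rcases v with v | v <;>
        rcases w with w | w <;> simp only [EnvLink] at h h'
      simpa using K.graph.eq_or_eq_of_isLink_of_isLink h h'
    · have h2 : s(x, y) = s(v, w) := Eq.trans h (Eq.symm h')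
      rcases Sym2.eq_iff.1 h2 with h3 | h3
      · exact Or.inl h3.1
      · exact Or.inr h3.1
    · have h2 : s(x, y) = s(v, w) := Eq.trans h (Eq.symm h')
      rcases Sym2.eq_iff.1 h2 with h3 | h3
      · exact Or.inl h3.1
      · exact Or.inr h3.1
  left_mem_of_isLink := by
    rintro (e | i | i) x y h v rfl
    · rcases y with y | y
      · exact Graph.IsLink.left_mem (G := K.graph) h
      · exact False.elim h
    · rcases Sym2.eq_iff.1 h with h3 | h3
      · rw [Sum.inl.inj h3.1]
        exact (K.boundary i).2
      · exact absurd h3.1 (by simp)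
    · rcases Sym2.eq_iff.1 h with h3 | h3 <;> exact absurd h3.1 (by simp)

/-- Incidence in `K^⊙`. The additional vertex is `none`. -/
def HubLink (K : BilabelledGraph k l) :
    (K.β ⊕ (Fin (k + l) ⊕ Fin (k + l))) ⊕ Fin (k + l) →
      Option (K.α ⊕ Fin (k + l)) → Option (K.α ⊕ Fin (k + l)) → Prop
  | .inl e, some x, some y => K.envelope.IsLink e x y
  | .inl _, _, _ => False
  | .inr i, x, y => s(x, y) = s(none, some (.inr i))

/-- The graph `K^⊙`: add to `K°` one more vertex, adjacent to every vertex of the enveloping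
cycle. -/
def hubEnvelope (K : BilabelledGraph k l) :
    Graph (Option (K.α ⊕ Fin (k + l))) ((K.β ⊕ (Fin (k + l) ⊕ Fin (k + l))) ⊕ Fin (k + l)) where
  vertexSet := {x | ∀ v, x = some v → v ∈ K.envelope.vertexSet}
  IsLink := K.HubLink
  isLink_symm := by
    rintro (e | i) - <;> refine ⟨?_⟩
    · rintro (_ | x) (_ | y) h
      · exact h
      · exact h
      · exact h
      · exact Graph.IsLink.symm (G := K.envelope) h
    · intro x y h; exact Sym2.eq_swap.trans h
  eq_or_eq_of_isLink_of_isLink := by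
    rintro (e | i) x y v w h h'
    · rcases x with _ | x <;> rcases y with _ | y <;> rcases v with _ | v <;>
        rcases w with _ | w <;> simp only [HubLink] at h h'
      simpa using K.envelope.eq_or_eq_of_isLink_of_isLink h h'
    · have h2 : s(x, y) = s(v, w) := Eq.trans h (Eq.symm h')
      rcases Sym2.eq_iff.1 h2 with h3 | h3
      · exact Or.inl h3.1
      · exact Or.inr h3.1
  left_mem_of_isLink := by
    rintro (e | i) x y h v rfl
    · rcases y with _ | y
      · exact False.elim h
      · exact Graph.IsLink.left_mem (G := K.envelope) h
    · rcases Sym2.eq_iff.1 h with h3 | h3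
      · exact absurd h3.1 (by simp)
      · rw [Option.some.inj h3.1]
        intro v hv
        exact absurd hv (by simp)

/-- The degree `d_v` of a vertex `v` in `K`. -/
noncomputable def deg (K : BilabelledGraph k l) (v : K.α) : ℕ := K.graph.deg v

/-- The extended degree of a vertex `v` of `K`: its degree in `K°`. -/
noncomputable def extDeg (K : BilabelledGraph k l) (v : K.α) : ℕ := K.envelope.deg (.inl v)

/-- A bilabelled graph is planar if `K^⊙` is a planar graph. -/
def IsPlanar (K : BilabelledGraph k l) : Prop := K.hubEnvelope.IsPlanar

/-- The conditions that define `C(k, l)`. -/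
structure IsReduced (K : BilabelledGraph k l) : Prop where
  /-- `K` is a planar bilabelled graph. -/
  planar : K.IsPlanar
  /-- All extended degrees are even. -/
  even_extDeg : ∀ v ∈ K.graph.vertexSet, Even (K.extDeg v)
  /-- The graph is bipartite, all input and output vertices being in one part `P`. -/
  bipartite : ∃ P : Set K.α, (∀ e x y, K.graph.IsLink e x y → (x ∈ P ↔ y ∉ P)) ∧
    (∀ i, (K.input i : K.α) ∈ P) ∧ (∀ j, (K.output j : K.α) ∈ P)
  /-- No vertex has both degree and extended degree equal to two. -/
  no_inner_deg_two : ¬ ∃ v ∈ K.graph.vertexSet, K.deg v = 2 ∧ K.extDeg v = 2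
  /-- There are no multiple edges. -/
  no_multiple_edges : ∀ e f x y, K.graph.IsLink e x y → K.graph.IsLink f x y → e = f
  /-- Every connected component contains an input or output vertex. -/
  component : ∀ v ∈ K.graph.vertexSet,
    (∃ i, Relation.ReflTransGen K.graph.Adj v (K.input i)) ∨
    (∃ j, Relation.ReflTransGen K.graph.Adj v (K.output j))

/-- Isomorphism of bilabelled graphs: bijections between the vertices and between the edges that
preserve incidence and the two tuples. -/
def Isomorphic (K K' : BilabelledGraph k l) : Prop :=
  ∃ (f : K.graph.vertexSet ≃ K'.graph.vertexSet) (g : K.graph.edgeSet ≃ K'.graph.edgeSet),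
    (∀ (e : K.graph.edgeSet) (x y : K.graph.vertexSet),
      K.graph.IsLink e x y ↔ K'.graph.IsLink (g e) (f x) (f y)) ∧
    (∀ i, f (K.input i) = K'.input i) ∧ (∀ j, f (K.output j) = K'.output j)

theorem Isomorphic.refl (K : BilabelledGraph k l) : Isomorphic K K :=
  ⟨Equiv.refl _, Equiv.refl _, fun _ _ _ => Iff.rfl, fun _ => rfl, fun _ => rfl⟩

theorem Isomorphic.symm {K K' : BilabelledGraph k l} (h : Isomorphic K K') : Isomorphic K' K := by
  obtain ⟨f, g, h1, h2, h3⟩ := h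
  refine ⟨f.symm, g.symm, fun e x y => ?_, fun i => ?_, fun j => ?_⟩
  · simpa using (h1 (g.symm e) (f.symm x) (f.symm y)).symm
  · rw [← h2, Equiv.symm_apply_apply]
  · rw [← h3, Equiv.symm_apply_apply]

theorem Isomorphic.trans {K K' K'' : BilabelledGraph k l} (h : Isomorphic K K')
    (h' : Isomorphic K' K'') : Isomorphic K K'' := by
  obtain ⟨f, g, h1, h2, h3⟩ := h
  obtain ⟨f', g', h1', h2', h3'⟩ := h'
  refine ⟨f.trans f', g.trans g', fun e x y => ?_, fun i => ?_, fun j => ?_⟩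
  · exact (h1 e x y).trans (h1' _ _ _)
  · simp [h2, h2']
  · simp [h3, h3']

/-- Bilabelled graphs up to isomorphism. -/
instance isoSetoid (k l : ℕ) : Setoid (BilabelledGraph k l) :=
  ⟨Isomorphic, Isomorphic.refl, Isomorphic.symm, Isomorphic.trans⟩

/-- The set `C(k, l)` of bilabelled graphs, taken up to isomorphism, that satisfy the conditions
`IsReduced`. -/
def C (k l : ℕ) : Set (Quotient (isoSetoid k l)) :=
  {c | ∃ K : BilabelledGraph k l, K.IsReduced ∧ Quotient.mk (isoSetoid k l) K = c}

end BilabelledGraph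

/-! Call a vertex of `K` inner if it is neither an input nor an output vertex. Its degrees in `K`
and `K°` agree and are even; they are not two, and not zero because its component meets the boundary
tuple. Without loops and multiple edges an inner vertex thus has at least four neighbours. Planarity
and bipartiteness turn this into an isoperimetric inequality: there are at most `(k + l) ^ 2` inner
vertices. Simple graphs of bounded order with two marked tuples form finitely many isomorphism
classes.

The inequality (`IsPatch.bound`) is proved by peeling off layers. Let `C` be a set of inner vertices
whose outer boundary `X` has one colour and is attached to a connected hub outside; at the start the
hub is the enveloping cycle with its centre. The layer `T` of vertices of `C` with a neighbour in
`X` has the other colour, so it is independent, and the components `D` of `C \ T` are smaller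
patches with hub enlarged by `X`. Euler's inequality `|E| + 4 ≤ 2|V|` for simple bipartite planar
graphs is applied to two minors, in which the hub and the components are contracted. Together with
the degree count on `T` and induction it gives `e(C, X) + 4 ≤ 2|X|` and then `|C| ≤ (|X| - 2)²`.

Planarity enters only through a Whitney dual: the cycle space over `ZMod 2` is the cut space of
another multigraph. This property passes to minors (`HasDual.minor`) and yields Euler's inequality
by linear algebra (`HasDual.card_edges_le`). For a straight-line drawing
(`IsStraightDrawing.hasDual`) no Jordan curve theorem is needed: a face is replaced by the function
that sends each cycle to the parity of its edges above a point of the face. -/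

/-! ### Whitney duals and minors -/

/-- The difference over `ZMod 2` of a vertex function along the edges with ends `s` and `t`. -/
def coboundary {E V : Type*} (s t : E → V) (p : V → ZMod 2) (e : E) : ZMod 2 := p (s e) + p (t e)

/-- The multigraph with edge ends `s` and `t` has a Whitney dual: a multigraph with edge ends `l`
and `r` whose cut space over `ZMod 2` is the cycle space of the given one. -/
def HasDual {E V : Type*} [Fintype E] (s t : E → V) : Prop :=
  ∃ (F : Type) (l r : E → F), ∀ Z : E → ZMod 2,
    (∃ g, coboundary l r g = Z) ↔ ∀ p, ∑ e, Z e * coboundary s t p e = 0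

/-- The range of a dual map is the annihilator of the kernel. This is what extends a cycle of a
contracted graph over the contracted edges. -/
theorem exists_dual_factor {V N : Type*} [Fintype N] (A : (V → ZMod 2) →ₗ[ZMod 2] (N → ZMod 2))
    (f : (V → ZMod 2) →ₗ[ZMod 2] ZMod 2) (h : ∀ p, A p = 0 → f p = 0) :
    ∃ m : N → ZMod 2, ∀ p, f p = ∑ e, m e * A p e := by
  classical
  have h1 : f ∈ LinearMap.range A.dualMap := by
    rw [LinearMap.range_dualMap_eq_dualAnnihilator_ker, Submodule.mem_dualAnnihilator]
    exact fun p hp => h p hp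
  obtain ⟨g, rfl⟩ := h1
  refine ⟨fun e => g (Pi.single e 1), fun p => ?_⟩
  rw [LinearMap.dualMap_apply]
  conv_lhs => rw [pi_eq_sum_univ' (A p), map_sum]
  refine Finset.sum_congr rfl fun e _ => ?_
  rw [map_smul, smul_eq_mul, mul_comm]

theorem zmod_two_add_eq_zero {a b : ZMod 2} : a + b = 0 ↔ a = b := by
  revert a b; decide

/-- A minor of a multigraph with a Whitney dual has a Whitney dual. The edges in `N` are
contracted, the edges outside of `N` and the range of `ρ` are deleted. -/
theorem HasDual.minor {E E' V V' : Type*} [Fintype E] [Fintype E'] {s t : E → V} {s' t' : E' → V'}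
    (H : HasDual s t) (ρ : E' → E) (hρ : Function.Injective ρ) (N : Set E)
    (hN : ∀ e, ρ e ∉ N)
    (h1 : ∀ p : V → ZMod 2, (∀ e ∈ N, coboundary s t p e = 0) →
      ∃ q, ∀ e, coboundary s t p (ρ e) = coboundary s' t' q e)
    (h2 : ∀ q : V' → ZMod 2, ∃ p, (∀ e ∈ N, coboundary s t p e = 0) ∧
      ∀ e, coboundary s t p (ρ e) = coboundary s' t' q e) : HasDual s' t' := by
  classical
  obtain ⟨F, l, r, H⟩ := H
  -- Deletion is dual to contraction: the two faces at a deleted edge are identified, while a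
  -- contracted edge simply disappears from the dual.
  let D : F → F → Prop := fun a b => ∃ e, e ∉ N ∧ e ∉ Set.range ρ ∧ a = l e ∧ b = r e
  refine ⟨Quot D, fun e => Quot.mk D (l (ρ e)), fun e => Quot.mk D (r (ρ e)), fun Z => ⟨?_, ?_⟩⟩
  · rintro ⟨g, rfl⟩ q
    obtain ⟨p, hp1, hp2⟩ := h2 q
    rw [← (H (coboundary l r (fun a => g (Quot.mk D a)))).1 ⟨_, rfl⟩ p]
    refine Fintype.sum_of_injective ρ hρ _ _ (fun e he => ?_) (fun e => ?_)
    · by_cases heN : e ∈ N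
      · rw [hp1 e heN, mul_zero]
      · have : Quot.mk D (l e) = Quot.mk D (r e) := Quot.sound ⟨e, heN, he, rfl, rfl⟩
        rw [coboundary, this, CharTwo.add_self_eq_zero, zero_mul]
    · rw [hp2]; rfl
  · intro hZ
    let A : (V → ZMod 2) →ₗ[ZMod 2] (N → ZMod 2) :=
      { toFun := fun p e => coboundary s t p e
        map_add' := fun p q => by ext e; simp only [coboundary, Pi.add_apply]; ring
        map_smul' := fun a p => by
          ext e; simp only [coboundary, Pi.smul_apply, smul_eq_mul, RingHom.id_apply]; ring }
    let f : (V → ZMod 2) →ₗ[ZMod 2] ZMod 2 :=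
      { toFun := fun p => ∑ e, Z e * coboundary s t p (ρ e)
        map_add' := fun p q => by
          rw [← Finset.sum_add_distrib]
          refine Finset.sum_congr rfl fun e _ => ?_
          simp only [coboundary, Pi.add_apply]; ring
        map_smul' := fun a p => by
          rw [RingHom.id_apply, smul_eq_mul, Finset.mul_sum]
          refine Finset.sum_congr rfl fun e _ => ?_
          simp only [coboundary, Pi.smul_apply, smul_eq_mul]; ring }
    -- The pairing with `Z` depends only on the differences along `N`; the coefficients `m` are the
    -- values on `N` that complete `Z` to a cycle `Z1 + Z2` of the large graph.
    obtain ⟨m, hm⟩ := exists_dual_factor A f (by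
      intro p hp
      obtain ⟨q, hq⟩ := h1 p (fun e he => congrFun hp ⟨e, he⟩)
      rw [← hZ q]
      exact Finset.sum_congr rfl fun e _ => by rw [hq])
    let Z1 : E → ZMod 2 := fun e => if h : e ∈ N then m ⟨e, h⟩ else 0
    let Z2 : E → ZMod 2 := fun e => if h : e ∈ Set.range ρ then Z h.choose else 0
    have hZ1 : ∀ e ∉ N, Z1 e = 0 := fun e he => dif_neg he
    have hZ2 : ∀ e, Z2 (ρ e) = Z e := fun e => by
      have h : ρ e ∈ Set.range ρ := ⟨e, rfl⟩
      simp only [Z2, dif_pos h]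
      rw [hρ h.choose_spec]
    have hZ2' : ∀ e ∉ Set.range ρ, Z2 e = 0 := fun e he => dif_neg he
    obtain ⟨g, hg⟩ := (H (Z1 + Z2)).2 (by
      intro p
      have e1 : ∑ e, Z1 e * coboundary s t p e = ∑ e, m e * A p e := by
        symm
        refine Fintype.sum_of_injective (Subtype.val : N → E) Subtype.val_injective _ _
          (fun e he => ?_) (fun e => ?_)
        · rw [hZ1 e (fun h => he ⟨⟨e, h⟩, rfl⟩), zero_mul]
        · simp only [Z1, dif_pos e.2]; rfl
      have e2 : ∑ e, Z2 e * coboundary s t p e = f p := by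
        symm
        refine Fintype.sum_of_injective ρ hρ _ _ (fun e he => ?_) (fun e => ?_)
        · rw [hZ2' e he, zero_mul]
        · rw [hZ2]
      simp only [Pi.add_apply, add_mul, Finset.sum_add_distrib]
      rw [e1, e2, hm, CharTwo.add_self_eq_zero])
    -- The completed cycle vanishes on deleted edges, so its potential `g` descends to the quotient.
    refine ⟨Quot.lift g ?_, ?_⟩
    · rintro _ _ ⟨e, heN, he, rfl, rfl⟩
      have := congrFun hg e
      rw [Pi.add_apply, hZ1 e heN, hZ2' e he, add_zero] at this
      exact zmod_two_add_eq_zero.1 this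
    · ext e
      have := congrFun hg (ρ e)
      rw [Pi.add_apply, hZ1 _ (hN e), hZ2, zero_add] at this
      exact this

/-! ### Euler's inequality -/

theorem coboundary_eq_sum {E F : Type*} [Fintype E] [DecidableEq F] (l r : E → F) (U : Finset F)
    (hl : ∀ e, l e ∈ U) (hr : ∀ e, r e ∈ U) (g : F → ZMod 2) :
    coboundary l r g = ∑ f ∈ U, g f • coboundary l r (Pi.single f 1) := by
  ext e
  simp only [coboundary, Finset.sum_apply, Pi.smul_apply, smul_eq_mul, mul_add,
    Finset.sum_add_distrib, Pi.single_apply, mul_ite, mul_one, mul_zero]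
  rw [Finset.sum_ite_eq, Finset.sum_ite_eq, if_pos (hl e), if_pos (hr e)]

/-- The cycle space has dimension at least `|E| - |V| + 1`. -/
theorem card_le_finrank_cycles {E V : Type*} [Fintype E] [Fintype V] [Nonempty V] (s t : E → V)
    (S : Submodule (ZMod 2) (E → ZMod 2))
    (hS : ∀ Z : E → ZMod 2, (∀ p, ∑ e, Z e * coboundary s t p e = 0) → Z ∈ S) :
    Fintype.card E + 1 ≤ Fintype.card V + Module.finrank (ZMod 2) S := by
  classical
  let Φ : (E → ZMod 2) →ₗ[ZMod 2] (V → ZMod 2) :=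
    { toFun := fun Z w => ∑ e, Z e * coboundary s t (Pi.single w 1) e
      map_add' := fun Z Z' => by
        ext w; simp only [Pi.add_apply, add_mul, Finset.sum_add_distrib]
      map_smul' := fun a Z => by
        ext w
        simp only [Pi.smul_apply, smul_eq_mul, mul_assoc, RingHom.id_apply, Finset.mul_sum] }
  let σ : (V → ZMod 2) →ₗ[ZMod 2] ZMod 2 := ∑ w, LinearMap.proj w
  have hker : LinearMap.ker Φ ≤ S := by
    intro Z hZ
    refine hS Z fun p => ?_
    have h1 := coboundary_eq_sum s t Finset.univ (fun _ => Finset.mem_univ _)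
      (fun _ => Finset.mem_univ _) p
    have h2 : ∀ w, ∑ e, Z e * coboundary s t (Pi.single w 1) e = 0 := fun w => congrFun hZ w
    rw [h1]
    simp only [Finset.sum_apply, Pi.smul_apply, smul_eq_mul, Finset.mul_sum]
    rw [Finset.sum_comm]
    refine Finset.sum_eq_zero fun w _ => ?_
    rw [← mul_zero (p w), ← h2 w, Finset.mul_sum]
    exact Finset.sum_congr rfl fun e _ => by ring
  -- Every edge has two ends, so a boundary has coordinate sum zero. Hence the boundary map `Φ` has
  -- rank at most `|V| - 1`.
  have hrange : LinearMap.range Φ ≤ LinearMap.ker σ := by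
    rintro _ ⟨Z, rfl⟩
    have h1 := coboundary_eq_sum s t Finset.univ (fun _ => Finset.mem_univ _)
      (fun _ => Finset.mem_univ _) (fun _ => 1)
    rw [LinearMap.mem_ker]
    simp only [σ, Φ, LinearMap.sum_apply, LinearMap.proj_apply, LinearMap.coe_mk, AddHom.coe_mk]
    rw [Finset.sum_comm]
    refine Finset.sum_eq_zero fun e _ => ?_
    have h2 := congrFun h1 e
    simp only [Finset.sum_apply, Pi.smul_apply, smul_eq_mul, one_mul] at h2
    rw [← Finset.mul_sum, ← h2, coboundary, CharTwo.add_self_eq_zero, mul_zero]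
  have hσ : Function.Surjective σ := by
    intro a
    obtain ⟨w⟩ := ‹Nonempty V›
    refine ⟨Pi.single w a, ?_⟩
    simp [σ, LinearMap.sum_apply, Pi.single_apply]
  have d1 := LinearMap.finrank_range_add_finrank_ker Φ
  have d2 := LinearMap.finrank_range_add_finrank_ker σ
  have d3 := Submodule.finrank_mono hker
  have d4 := Submodule.finrank_mono hrange
  rw [LinearMap.range_eq_top.2 hσ, finrank_top, Module.finrank_self] at d2
  rw [Module.finrank_fintype_fun_eq_card] at d1 d2
  omega

/-- Euler's inequality for a multigraph with a Whitney dual all of whose nonempty cycles have at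
least four edges. -/
theorem HasDual.card_edges_le {E V : Type*} [Fintype E] [Fintype V] {s t : E → V}
    (H : HasDual s t) (hV : 3 ≤ Fintype.card V)
    (hZ : ∀ Z : E → ZMod 2, (∀ p, ∑ e, Z e * coboundary s t p e = 0) → Z ≠ 0 →
      4 ≤ (Finset.univ.filter fun e => Z e ≠ 0).card) :
    Fintype.card E + 4 ≤ 2 * Fintype.card V := by
  classical
  obtain ⟨F, l, r, H⟩ := H
  have : Nonempty V := Fintype.card_pos_iff.1 (by omega)
  let row : F → E → ZMod 2 := fun f => coboundary l r (Pi.single f 1)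
  let U : Finset F := Finset.univ.image l ∪ Finset.univ.image r
  -- Faces with zero row are dropped: only a nonzero row is a nonempty cycle with at least four
  -- edges.
  let U' := U.filter fun f => row f ≠ 0
  have hsum : ∀ g, coboundary l r g = ∑ f ∈ U', g f • row f := by
    intro g
    rw [coboundary_eq_sum l r U (fun e => by simp [U]) (fun e => by simp [U]), Finset.sum_filter]
    refine Finset.sum_congr rfl fun f _ => ?_
    split_ifs with h
    · rfl
    · rw [not_not] at h
      change g f • row f = 0
      rw [h, smul_zero]
  obtain ⟨T, hT, hTc⟩ : ∃ T : Finset (E → ZMod 2),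
      (∀ g, coboundary l r g ∈ Submodule.span (ZMod 2) (T : Set (E → ZMod 2))) ∧
        T.card ≤ U'.card - 1 := by
    rcases U'.eq_empty_or_nonempty with h | ⟨f0, hf0⟩
    · refine ⟨∅, fun g => ?_, by simp⟩
      rw [hsum, h, Finset.sum_empty]
      exact Submodule.zero_mem _
    · refine ⟨(U'.erase f0).image row, fun g => ?_, ?_⟩
      -- Adding the constant `g f0` to a potential leaves its coboundary unchanged, so the row of
      -- `f0` is not needed.
      · have : coboundary l r g = coboundary l r (fun f => g f + g f0) := by
          ext e
          simp only [coboundary]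
          have := CharTwo.add_self_eq_zero (g f0)
          linear_combination -this
        rw [this, hsum, ← Finset.add_sum_erase _ _ hf0, CharTwo.add_self_eq_zero, zero_smul,
          zero_add]
        refine Submodule.sum_mem _ fun f hf => Submodule.smul_mem _ _ (Submodule.subset_span ?_)
        exact Finset.mem_coe.2 (Finset.mem_image_of_mem _ hf)
      · rw [← Finset.card_erase_of_mem hf0]
        exact Finset.card_image_le
  have d1 := card_le_finrank_cycles s t (Submodule.span (ZMod 2) (T : Set (E → ZMod 2)))
    (fun Z hZ => by
      obtain ⟨g, rfl⟩ := (H Z).2 hZ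
      exact hT g)
  have d2 := finrank_span_finset_le_card (R := ZMod 2) T
  rw [Set.finrank] at d2
  have d3 : U'.card * 4 ≤ ∑ f ∈ U', (Finset.univ.filter fun e => row f e ≠ 0).card := by
    rw [← smul_eq_mul]
    refine Finset.card_nsmul_le_sum _ _ _ fun f hf => ?_
    exact hZ _ ((H _).1 ⟨_, rfl⟩) (Finset.mem_filter.1 hf).2
  have d4 : ∑ f ∈ U', (Finset.univ.filter fun e => row f e ≠ 0).card ≤ 2 * Fintype.card E := by
    have : ∀ f, (Finset.univ.filter fun e => row f e ≠ 0).card ≤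
        (Finset.univ.filter fun e => l e = f).card +
          (Finset.univ.filter fun e => r e = f).card := by
      intro f
      refine le_trans (Finset.card_le_card ?_) (Finset.card_union_le _ _)
      intro e he
      simp only [Finset.mem_filter, Finset.mem_univ, true_and, Finset.mem_union] at he ⊢
      by_contra h
      push Not at h
      exact he (by simp [row, coboundary, h.1, h.2])
    refine le_trans (Finset.sum_le_sum fun f _ => this f) ?_
    rw [Finset.sum_add_distrib, two_mul]
    refine add_le_add ?_ ?_
    · exact (Finset.sum_card_fiberwise_eq_card_filter Finset.univ U' l).trans_le
        (Finset.card_filter_le _ _)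
    · exact (Finset.sum_card_fiberwise_eq_card_filter Finset.univ U' r).trans_le
        (Finset.card_filter_le _ _)
  -- From `|E| + 1 ≤ |V| + (|U'| - 1)` and `4|U'| ≤ 2|E|`. If `U'` is empty, the subtraction
  -- truncates and `hV` is needed.
  omega

/-- A nonempty cycle in a simple bipartite graph has at least four edges. -/
theorem four_le_card_cycle {A B : Type*} (R : Finset (A × B)) (Z : R → ZMod 2)
    (hZ : ∀ p, ∑ e, Z e * coboundary (fun e : R => (Sum.inl e.1.1 : A ⊕ B))
      (fun e : R => Sum.inr e.1.2) p e = 0) (h0 : Z ≠ 0) :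
    4 ≤ (Finset.univ.filter fun e => Z e ≠ 0).card := by
  classical
  -- Pairing with the indicator of one vertex shows that no vertex lies on exactly one edge of `Z`.
  have hA : ∀ e, Z e ≠ 0 → ∃ f, f ≠ e ∧ Z f ≠ 0 ∧ f.1.1 = e.1.1 := by
    intro e he
    by_contra h
    push Not at h
    have := hZ (fun w => if w = Sum.inl e.1.1 then 1 else 0)
    rw [Finset.sum_eq_single e] at this
    · simp [coboundary] at this
      exact he this
    · intro f _ hf
      by_cases h1 : Z f = 0
      · rw [h1, zero_mul]
      · simp [coboundary, h f hf h1]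
    · simp
  have hB : ∀ e, Z e ≠ 0 → ∃ f, f ≠ e ∧ Z f ≠ 0 ∧ f.1.2 = e.1.2 := by
    intro e he
    by_contra h
    push Not at h
    have := hZ (fun w => if w = Sum.inr e.1.2 then 1 else 0)
    rw [Finset.sum_eq_single e] at this
    · simp [coboundary] at this
      exact he this
    · intro f _ hf
      by_cases h1 : Z f = 0
      · rw [h1, zero_mul]
      · simp [coboundary, h f hf h1]
    · simp
  have hne : ∀ {e f : R}, e.1.1 = f.1.1 → e.1.2 = f.1.2 → e = f := fun h1 h2 =>
    Subtype.ext (Prod.ext h1 h2)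
  obtain ⟨e, he⟩ := Function.ne_iff.1 h0
  obtain ⟨f, hf1, hf2, hf3⟩ := hA e he
  obtain ⟨g, hg1, hg2, hg3⟩ := hB e he
  obtain ⟨h, hh1, hh2, hh3⟩ := hB f hf2
  have n1 : g ≠ f := fun h => hf1 (hne hf3 (by rw [← h, hg3]))
  have n2 : h ≠ e := fun h => hf1 (hne hf3 (by rw [← hh3, h]))
  have n3 : h ≠ g := fun h => hf1 (hne hf3 (by rw [← hh3, h, hg3]))
  have : ({e, f, g, h} : Finset R) ⊆ Finset.univ.filter fun e => Z e ≠ 0 := by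
    intro x hx
    simp only [Finset.mem_insert, Finset.mem_singleton] at hx
    rw [Finset.mem_filter]
    refine ⟨Finset.mem_univ _, ?_⟩
    rcases hx with rfl | rfl | rfl | rfl <;> assumption
  refine le_trans (le_of_eq ?_) (Finset.card_le_card this)
  rw [Finset.card_insert_of_notMem, Finset.card_insert_of_notMem, Finset.card_insert_of_notMem,
    Finset.card_singleton]
  · simpa using n3.symm
  · simp [n1.symm, hh1.symm]
  · simp [hf1.symm, hg1.symm, n2.symm]

/-! ### Contracting connected sets -/

/-- Connectedness of a vertex set, in the form that is needed for contracting it. -/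
def ConnectedSet {V : Type*} (adj : V → V → Prop) (S : Set V) : Prop :=
  ∀ p : V → ZMod 2, (∀ u ∈ S, ∀ v ∈ S, adj u v → p u = p v) → ∀ u ∈ S, ∀ v ∈ S, p u = p v

/-- The number of adjacent pairs between two families of pairwise disjoint connected vertex sets
in a multigraph with a Whitney dual. -/
theorem HasDual.card_pairs_le {E V A B : Type*} [Fintype E] [Fintype A] [Fintype B] {s t : E → V}
    (H : HasDual s t) {adj : V → V → Prop}
    (hadj : ∀ u v, adj u v → ∃ e, s e = u ∧ t e = v ∨ s e = v ∧ t e = u)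
    (f : A ⊕ B → Set V) (hf : ∀ w w' v, v ∈ f w → v ∈ f w' → w = w')
    (hc : ∀ w, ConnectedSet adj (f w)) (R : Finset (A × B))
    (hR : ∀ a b, (a, b) ∈ R → ∃ u ∈ f (.inl a), ∃ v ∈ f (.inr b), adj u v)
    (h3 : 3 ≤ Fintype.card A + Fintype.card B) :
    R.card + 4 ≤ 2 * (Fintype.card A + Fintype.card B) := by
  classical
  have hρ : ∀ x : R, ∃ e, (s e ∈ f (.inl x.1.1) ∧ t e ∈ f (.inr x.1.2)) ∨
      (s e ∈ f (.inr x.1.2) ∧ t e ∈ f (.inl x.1.1)) := by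
    rintro ⟨⟨a, b⟩, hx⟩
    obtain ⟨u, hu, v, hv, huv⟩ := hR a b hx
    obtain ⟨e, ⟨rfl, rfl⟩ | ⟨rfl, rfl⟩⟩ := hadj u v huv
    · exact ⟨e, Or.inl ⟨hu, hv⟩⟩
    · exact ⟨e, Or.inr ⟨hv, hu⟩⟩
  choose ρ hρ using hρ
  have key : HasDual (fun e : R => (Sum.inl e.1.1 : A ⊕ B)) (fun e : R => Sum.inr e.1.2) := by
    -- Edges inside one of the sets are contracted, one edge `ρ x` is kept for each pair `x` in `R`,
    -- and all others are deleted.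
    refine H.minor ρ ?_ {e | ∃ w, s e ∈ f w ∧ t e ∈ f w} ?_ ?_ ?_
    · intro x y hxy
      have hx := hρ x
      have hy := hρ y
      rw [← hxy] at hy
      refine Subtype.ext (Prod.ext ?_ ?_)
      · rcases hx with hx | hx <;> rcases hy with hy | hy
        · exact Sum.inl.inj (hf _ _ _ hx.1 hy.1)
        · exact absurd (hf _ _ _ hx.1 hy.1) (by simp)
        · exact absurd (hf _ _ _ hx.1 hy.1) (by simp)
        · exact Sum.inl.inj (hf _ _ _ hx.2 hy.2)
      · rcases hx with hx | hx <;> rcases hy with hy | hy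
        · exact Sum.inr.inj (hf _ _ _ hx.2 hy.2)
        · exact absurd (hf _ _ _ hx.1 hy.1) (by simp)
        · exact absurd (hf _ _ _ hx.1 hy.1) (by simp)
        · exact Sum.inr.inj (hf _ _ _ hx.1 hy.1)
    · rintro x ⟨w, h1, h2⟩
      rcases hρ x with hx | hx
      · exact absurd ((hf _ _ _ hx.1 h1).trans (hf _ _ _ hx.2 h2).symm) (by simp)
      · exact absurd ((hf _ _ _ hx.1 h1).trans (hf _ _ _ hx.2 h2).symm) (by simp)
    · intro p hp
      have hconst : ∀ w, ∀ u ∈ f w, ∀ v ∈ f w, p u = p v := by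
        intro w
        refine hc w p fun u hu v hv huv => ?_
        obtain ⟨e, ⟨rfl, rfl⟩ | ⟨rfl, rfl⟩⟩ := hadj u v huv
        · exact zmod_two_add_eq_zero.1 (hp e ⟨w, hu, hv⟩)
        · exact (zmod_two_add_eq_zero.1 (hp e ⟨w, hv, hu⟩)).symm
      let q : A ⊕ B → ZMod 2 := fun w => if h : (f w).Nonempty then p h.some else 0
      have hq : ∀ w, ∀ u ∈ f w, p u = q w := by
        intro w u hu
        have h : (f w).Nonempty := ⟨u, hu⟩
        simp only [q, dif_pos h]
        exact hconst w u hu _ h.some_mem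
      refine ⟨q, fun x => ?_⟩
      simp only [coboundary]
      rcases hρ x with hx | hx
      · rw [hq _ _ hx.1, hq _ _ hx.2]
      · rw [hq _ _ hx.1, hq _ _ hx.2, add_comm]
    · intro q
      -- The default value outside of all the sets is harmless, since edges with an end there are
      -- deleted.
      let p : V → ZMod 2 := fun v => if h : ∃ w, v ∈ f w then q h.choose else 0
      have hp : ∀ w, ∀ u ∈ f w, p u = q w := by
        intro w u hu
        have h : ∃ w, u ∈ f w := ⟨w, hu⟩
        simp only [p, dif_pos h]
        rw [hf _ _ _ h.choose_spec hu]
      refine ⟨p, ?_, fun x => ?_⟩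
      · rintro e ⟨w, h1, h2⟩
        rw [coboundary, hp _ _ h1, hp _ _ h2, CharTwo.add_self_eq_zero]
      · simp only [coboundary]
        rcases hρ x with hx | hx
        · rw [hp _ _ hx.1, hp _ _ hx.2]
        · rw [hp _ _ hx.1, hp _ _ hx.2, add_comm]
  have := key.card_edges_le (by rwa [Fintype.card_sum]) (four_le_card_cycle R)
  rwa [Fintype.card_sum, Fintype.card_coe] at this

/-! ### Duals of straight-line drawings -/

/-- The height at `x` of the line through `a` and `b`. -/
noncomputable def lineHeight (a b : ℝ × ℝ) (x : ℝ) : ℝ :=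
  a.2 + (x - a.1) * ((b.2 - a.2) / (b.1 - a.1))

theorem lineHeight_left (a b : ℝ × ℝ) : lineHeight a b a.1 = a.2 := by simp [lineHeight]

theorem lineHeight_right {a b : ℝ × ℝ} (h : a.1 < b.1) : lineHeight a b b.1 = b.2 := by
  have : b.1 - a.1 ≠ 0 := (sub_pos.2 h).ne'
  rw [lineHeight]; field_simp; ring

theorem continuous_lineHeight (a b : ℝ × ℝ) : Continuous (lineHeight a b) := by
  unfold lineHeight; fun_prop

theorem lt_iff_lt_of_ne_on {f g : ℝ → ℝ} (hf : Continuous f) (hg : Continuous g) {a b : ℝ}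
    (hab : a ≤ b) (h : ∀ z ∈ Set.Icc a b, f z ≠ g z) : f a < g a ↔ f b < g b := by
  have hc : ContinuousOn (fun z => g z - f z) (Set.Icc a b) := (hg.sub hf).continuousOn
  constructor <;> intro h1 <;> by_contra h2
  · obtain ⟨z, hz, h0⟩ := intermediate_value_Icc' hab hc (show (0 : ℝ) ∈ _ from
      ⟨by linarith, by linarith⟩)
    exact h z hz (by linarith)
  · obtain ⟨z, hz, h0⟩ := intermediate_value_Icc hab hc (show (0 : ℝ) ∈ _ from
      ⟨by linarith, by linarith⟩)
    exact h z hz (by linarith)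

/-- Listed from the top down, the edges at a vertex have the partial sums of `z` on their two sides,
so each lower side is the upper side of the next edge. -/
theorem sum_telescope {ι M : Type*} [AddCommMonoid M] [DecidableEq ι] (S : Finset ι) (η : ι → ℝ)
    (hη : Set.InjOn η S) (g : M → ZMod 2) (T : M) (z : ι → M) :
    ∑ e ∈ S, (g (T + ∑ f ∈ S, if η e < η f then z f else 0) +
      g (T + (∑ f ∈ S, if η e < η f then z f else 0) + z e)) = g T + g (T + ∑ e ∈ S, z e) := by
  induction S using Finset.induction_on_min_value η with
  | empty => simp [CharTwo.add_self_eq_zero]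
  | insert a S ha hmin ih =>
    rw [Finset.coe_insert] at hη
    rw [Finset.sum_insert ha]
    have h1 : ∀ e ∈ S, (∑ f ∈ insert a S, if η e < η f then z f else 0) =
        ∑ f ∈ S, if η e < η f then z f else 0 := fun e he => by
      rw [Finset.sum_insert ha, if_neg (not_lt.2 (hmin e he)), zero_add]
    have h2 : (∑ f ∈ insert a S, if η a < η f then z f else 0) = ∑ f ∈ S, z f := by
      rw [Finset.sum_insert ha, if_neg (lt_irrefl _), zero_add]
      refine Finset.sum_congr rfl fun f hf => if_pos (lt_of_le_of_ne (hmin f hf) fun h => ?_)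
      have := hη (Set.mem_insert _ _) (Set.mem_insert_of_mem _ hf) h
      exact ha (this ▸ hf)
    have h3 : ∑ e ∈ S, (g (T + ∑ f ∈ insert a S, if η e < η f then z f else 0) +
        g (T + (∑ f ∈ insert a S, if η e < η f then z f else 0) + z e)) =
          g T + g (T + ∑ e ∈ S, z e) := by
      rw [← ih (hη.mono (Set.subset_insert _ _))]
      exact Finset.sum_congr rfl fun e he => by rw [h1 e he]
    rw [h3, h2, Finset.sum_insert ha, add_comm (z a), add_assoc T]
    have := CharTwo.add_self_eq_zero (g (T + ∑ f ∈ S, z f))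
    linear_combination this

/-- A straight-line drawing without vertical edges; every edge is directed to the right. -/
structure IsStraightDrawing {E : Type*} (s t : E → ℝ × ℝ) : Prop where
  lt : ∀ e, (s e).1 < (t e).1
  ne : ∀ e f x, e ≠ f → (s e).1 < x → x < (t e).1 → (s f).1 < x → x < (t f).1 →
    lineHeight (s e) (t e) x ≠ lineHeight (s f) (t f) x
  ne_left : ∀ e f, (s e).1 < (s f).1 → (s f).1 < (t e).1 →
    lineHeight (s e) (t e) (s f).1 ≠ (s f).2
  ne_right : ∀ e f, (s e).1 < (t f).1 → (t f).1 < (t e).1 →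
    lineHeight (s e) (t e) (t f).1 ≠ (t f).2

open Classical in
/-- The sum of `Z` over all edges that are above the edge `e` at `x`. -/
noncomputable def sumAbove {E : Type*} [Fintype E] (s t : E → ℝ × ℝ) (Z : E → ZMod 2) (e : E)
    (x : ℝ) : ZMod 2 :=
  ∑ f, if (s f).1 < x ∧ x < (t f).1 ∧ lineHeight (s e) (t e) x < lineHeight (s f) (t f) x
    then Z f else 0

open Classical in
/-- The sum of `Z` over all edges that are above the point `v` and continue to its right. -/
noncomputable def sumAboveRight {E : Type*} [Fintype E] (s t : E → ℝ × ℝ) (Z : E → ZMod 2)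
    (v : ℝ × ℝ) : ZMod 2 :=
  ∑ f, if (s f).1 ≤ v.1 ∧ v.1 < (t f).1 ∧ v.2 < lineHeight (s f) (t f) v.1 then Z f else 0

open Classical in
/-- The sum of `Z` over all edges that are above the point `v` and continue to its left. -/
noncomputable def sumAboveLeft {E : Type*} [Fintype E] (s t : E → ℝ × ℝ) (Z : E → ZMod 2)
    (v : ℝ × ℝ) : ZMod 2 :=
  ∑ f, if (s f).1 < v.1 ∧ v.1 ≤ (t f).1 ∧ v.2 < lineHeight (s f) (t f) v.1 then Z f else 0

namespace IsStraightDrawing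

variable {E : Type*} {s t : E → ℝ × ℝ}

theorem height_ne (H : IsStraightDrawing s t) {e f : E} (hef : e ≠ f) {z : ℝ} (h1 : (s e).1 < z)
    (h2 : z < (t e).1) (h3 : (s f).1 ≤ z) (h4 : z ≤ (t f).1) :
    lineHeight (s e) (t e) z ≠ lineHeight (s f) (t f) z := by
  rcases h3.lt_or_eq with h3 | rfl
  · rcases h4.lt_or_eq with h4 | rfl
    · exact H.ne e f z hef h1 h2 h3 h4
    · rw [lineHeight_right (H.lt f)]
      exact H.ne_right e f h1 h2
  · rw [lineHeight_left]
    exact H.ne_left e f h1 h2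

variable [Fintype E]

/-- The difference of the two sides is the pairing of `Z` with the coboundary of an indicator, that
of the points above `e` with abscissa strictly between `x` and `x'`. No edge crosses `e`, so an edge
contributes to the change only through its ends in that region. -/
theorem sumAbove_eq (H : IsStraightDrawing s t) {Z : E → ZMod 2}
    (hZ : ∀ p, ∑ e, Z e * coboundary s t p e = 0) (e : E) {x x' : ℝ} (hxx : x ≤ x')
    (h1 : (s e).1 < x) (h2 : x' < (t e).1) (hx : ∀ f, (s f).1 ≠ x ∧ (t f).1 ≠ x)
    (hx' : ∀ f, (s f).1 ≠ x' ∧ (t f).1 ≠ x') : sumAbove s t Z e x = sumAbove s t Z e x' := by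
  classical
  rw [← zmod_two_add_eq_zero,
    ← hZ (fun z => if x < z.1 ∧ z.1 < x' ∧ lineHeight (s e) (t e) z.1 < z.2 then 1 else 0),
    sumAbove, sumAbove, ← Finset.sum_add_distrib]
  refine Finset.sum_congr rfl fun f _ => ?_
  simp only [coboundary]
  have hf := H.lt f
  by_cases hfe : f = e
  · subst hfe
    simp [not_lt.2 h1.le, not_lt.2 h2.le]
  by_cases hl : (t f).1 < x
  · rw [if_neg, if_neg, if_neg, if_neg]
    · simp
    all_goals rintro ⟨h3, h4, h5⟩; linarith
  by_cases hr : x' < (s f).1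
  · rw [if_neg, if_neg, if_neg, if_neg]
    · simp
    all_goals rintro ⟨h3, h4, h5⟩; linarith
  have hl : x < (t f).1 := lt_of_le_of_ne (not_lt.1 hl) (hx f).2.symm
  have hr : (s f).1 < x' := lt_of_le_of_ne (not_lt.1 hr) (hx' f).1
  have hcmp := lt_iff_lt_of_ne_on (continuous_lineHeight (s e) (t e))
    (continuous_lineHeight (s f) (t f)) (a := max (s f).1 x) (b := min (t f).1 x')
    (by simp only [max_le_iff, le_min_iff]; exact ⟨⟨hf.le, hl.le⟩, hr.le, hxx⟩)
    (fun z hz => by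
      simp only [Set.mem_Icc, max_le_iff, le_min_iff] at hz
      exact H.height_ne (Ne.symm hfe) (by linarith) (by linarith) hz.1.1 hz.2.1)
  rcases (hx f).1.lt_or_gt with ha | ha <;> rcases (hx' f).2.lt_or_gt with hb | hb
  · rw [max_eq_right ha.le, min_eq_left hb.le, lineHeight_right hf] at hcmp
    simp [ha, hl, hb, not_lt.2 ha.le, not_lt.2 hb.le, hcmp]
  · rw [max_eq_right ha.le, min_eq_right hb.le] at hcmp
    simp [ha, hl, hr, hb, not_lt.2 ha.le, not_lt.2 hb.le, hcmp, CharTwo.add_self_eq_zero]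
  · rw [max_eq_left ha.le, min_eq_left hb.le, lineHeight_left, lineHeight_right hf] at hcmp
    simp [ha, hl, hr, hb, not_lt.2 ha.le, not_lt.2 hb.le, hcmp, CharTwo.add_self_eq_zero]
  · rw [max_eq_left ha.le, min_eq_right hb.le, lineHeight_left] at hcmp
    simp [ha, hr, hb, not_lt.2 ha.le, not_lt.2 hb.le, hcmp]

/-- The two sides differ by the pairing of the cycle `Z` with the coboundary of the indicator of the
open vertical ray above `v`. -/
theorem sumAboveRight_eq_left (H : IsStraightDrawing s t) {Z : E → ZMod 2}
    (hZ : ∀ p, ∑ e, Z e * coboundary s t p e = 0) (v : ℝ × ℝ) :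
    sumAboveRight s t Z v = sumAboveLeft s t Z v := by
  classical
  rw [← zmod_two_add_eq_zero, ← hZ (fun z => if z.1 = v.1 ∧ v.2 < z.2 then 1 else 0),
    sumAboveRight, sumAboveLeft, ← Finset.sum_add_distrib]
  refine Finset.sum_congr rfl fun f _ => ?_
  simp only [coboundary]
  have hf := H.lt f
  rcases lt_trichotomy (s f).1 v.1 with h1 | h1 | h1
  · rcases lt_trichotomy (t f).1 v.1 with h2 | h2 | h2
    · simp [h1.ne, h2.ne, not_lt.2 h2.le, not_le.2 h2]
    · have := lineHeight_right hf
      rw [h2] at this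
      simp [h1.ne, h2, h1, this]
    · simp [h1.ne, h2.ne', h1, h1.le, h2, h2.le, CharTwo.add_self_eq_zero]
  · have := lineHeight_left (s f) (t f)
    rw [h1] at this hf
    simp [h1, hf, hf.ne', this]
  · have h2 := h1.trans hf
    simp [h1.ne', h2.ne', not_le.2 h1, not_lt.2 h1.le]

/-- Nothing begins or ends strictly between the start of `e` and `x`, so an edge above `e` at `x`
either passes above the start of `e` or leaves that same point at a higher slope. -/
theorem sumAbove_right (H : IsStraightDrawing s t) (Z : E → ZMod 2) (e : E) {x : ℝ}
    (hx : (s e).1 < x) (hs : ∀ f, (s f).1 < x ↔ (s f).1 ≤ (s e).1)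
    (ht : ∀ f, x < (t f).1 ↔ (s e).1 < (t f).1) [DecidableEq E] [DecidableEq (ℝ × ℝ)] :
    sumAbove s t Z e x = sumAboveRight s t Z (s e) +
      ∑ f with s f = s e, if lineHeight (s e) (t e) x < lineHeight (s f) (t f) x
        then Z f else 0 := by
  rw [sumAbove, sumAboveRight, Finset.sum_filter, ← Finset.sum_add_distrib]
  refine Finset.sum_congr rfl fun f _ => ?_
  simp only [hs, ht]
  by_cases hf : s f = s e
  · have h1 : lineHeight (s f) (t f) (s e).1 = (s e).2 := by rw [← hf, lineHeight_left]
    have h2 : (s e).1 < (t f).1 := by rw [← hf]; exact H.lt f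
    simp [hf, h2, lineHeight_left]
  · rw [if_neg hf, add_zero]
    by_cases h1 : (s f).1 ≤ (s e).1 ∧ (s e).1 < (t f).1
    · have := lt_iff_lt_of_ne_on (continuous_lineHeight (s e) (t e))
        (continuous_lineHeight (s f) (t f)) hx.le (fun z hz => by
          have hfe : e ≠ f := fun h => hf (by rw [h])
          have h2 := (ht f).2 h1.2
          rcases h1.1.lt_or_eq with h3 | h3
          · refine (H.height_ne hfe.symm ?_ ?_ hz.1 ?_).symm
            · linarith [hz.1]
            · linarith [hz.2]
            · linarith [hz.2, (ht e).2 (H.lt e)]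
          · rcases hz.1.lt_or_eq with h4 | rfl
            · refine H.height_ne hfe h4 ?_ ?_ ?_
              · linarith [hz.2, (ht e).2 (H.lt e)]
              · linarith
              · linarith [hz.2]
            · rw [lineHeight_left, ← h3, lineHeight_left]
              exact fun h => hf (Prod.ext h3 h.symm))
      rw [lineHeight_left] at this
      simp [h1, this]
    · rw [if_neg (fun h => h1 ⟨h.1, h.2.1⟩), if_neg (fun h => h1 ⟨h.1, h.2.1⟩)]

theorem sumAbove_left (H : IsStraightDrawing s t) (Z : E → ZMod 2) (e : E) {x : ℝ}
    (hx : x < (t e).1) (ht : ∀ f, x < (t f).1 ↔ (t e).1 ≤ (t f).1)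
    (hs : ∀ f, (s f).1 < x ↔ (s f).1 < (t e).1) [DecidableEq E] [DecidableEq (ℝ × ℝ)] :
    sumAbove s t Z e x = sumAboveLeft s t Z (t e) +
      ∑ f with t f = t e, if lineHeight (s e) (t e) x < lineHeight (s f) (t f) x
        then Z f else 0 := by
  rw [sumAbove, sumAboveLeft, Finset.sum_filter, ← Finset.sum_add_distrib]
  refine Finset.sum_congr rfl fun f _ => ?_
  simp only [hs, ht]
  by_cases hf : t f = t e
  · have h1 : lineHeight (s f) (t f) (t e).1 = (t e).2 := by
      rw [← hf, lineHeight_right (H.lt f)]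
    have h2 : (s f).1 < (t e).1 := by rw [← hf]; exact H.lt f
    rw [hf] at h1
    simp [hf, h2, h1]
  · rw [if_neg hf, add_zero]
    by_cases h1 : (s f).1 < (t e).1 ∧ (t e).1 ≤ (t f).1
    · have := lt_iff_lt_of_ne_on (continuous_lineHeight (s e) (t e))
        (continuous_lineHeight (s f) (t f)) hx.le (fun z hz => by
          have hfe : e ≠ f := fun h => hf (by rw [h])
          have h2 := (hs f).2 h1.1
          rcases h1.2.lt_or_eq with h3 | h3
          · refine (H.height_ne hfe.symm ?_ ?_ ?_ hz.2).symm
            · linarith [hz.1]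
            · linarith [hz.2]
            · linarith [hz.1, (hs e).2 (H.lt e)]
          · rcases hz.2.lt_or_eq with h4 | rfl
            · refine H.height_ne hfe ?_ h4 ?_ ?_
              · linarith [hz.1, (hs e).2 (H.lt e)]
              · linarith [hz.1]
              · linarith
            · rw [lineHeight_right (H.lt e), h3, lineHeight_right (H.lt f)]
              exact fun h => hf (Prod.ext h3.symm h.symm))
      rw [lineHeight_right (H.lt e)] at this
      simp [h1, this]
    · rw [if_neg (fun h => h1 ⟨h.1, h.2.1⟩), if_neg (fun h => h1 ⟨h.1, h.2.1⟩)]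

theorem exists_gap (X : Finset ℝ) : ∃ δ > 0, ∀ a ∈ X, ∀ b ∈ X, a < b → a + 2 * δ < b := by
  have : ∀ᶠ δ : ℝ in nhdsWithin 0 (Set.Ioi 0), ∀ a ∈ X, ∀ b ∈ X, a < b → a + 2 * δ < b := by
    rw [Filter.eventually_all_finset]
    intro a _
    rw [Filter.eventually_all_finset]
    intro b _
    by_cases h : a < b
    · filter_upwards [Ioo_mem_nhdsGT (show (0 : ℝ) < (b - a) / 2 by linarith)] with δ hδ _
      linarith [hδ.2]
    · exact Filter.Eventually.of_forall fun _ h' => absurd h' h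
  obtain ⟨δ, h1, h2⟩ := (this.and self_mem_nhdsWithin).exists
  exact ⟨δ, h2, h1⟩

end IsStraightDrawing

/-- A straight-line plane multigraph has a Whitney dual. -/
theorem IsStraightDrawing.hasDual {E : Type} [Fintype E] {s t : E → ℝ × ℝ}
    (H : IsStraightDrawing s t) : HasDual s t := by
  classical
  -- The gap is `2 * δ` so that `(s e).1 + δ` still lies to the left of `(t e).1 - δ`.
  obtain ⟨δ, hδ, hgap⟩ := IsStraightDrawing.exists_gap
    (Finset.univ.image (fun e => (s e).1) ∪ Finset.univ.image fun e => (t e).1)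
  have hss : ∀ e f, (s e).1 < (s f).1 → (s e).1 + 2 * δ < (s f).1 := fun e f =>
    hgap _ (by simp) _ (by simp)
  have hst : ∀ e f, (s e).1 < (t f).1 → (s e).1 + 2 * δ < (t f).1 := fun e f =>
    hgap _ (by simp) _ (by simp)
  have htt : ∀ e f, (t e).1 < (t f).1 → (t e).1 + 2 * δ < (t f).1 := fun e f =>
    hgap _ (by simp) _ (by simp)
  let Cyc := {Z : E → ZMod 2 // ∀ p, ∑ e, Z e * coboundary s t p e = 0}
  let z : E → Cyc → ZMod 2 := fun e Z => Z.1 e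
  let l : E → Cyc → ZMod 2 := fun e Z => sumAbove s t Z.1 e ((s e).1 + δ)
  let TR : ℝ × ℝ → Cyc → ZMod 2 := fun v Z => sumAboveRight s t Z.1 v
  let TL : ℝ × ℝ → Cyc → ZMod 2 := fun v Z => sumAboveLeft s t Z.1 v
  have hl : ∀ v e, s e = v → l e = TR v + ∑ f with s f = v,
      if lineHeight (s e) (t e) (v.1 + δ) < lineHeight (s f) (t f) (v.1 + δ) then z f else 0 := by
    rintro _ e rfl
    ext Z
    simp only [l, TR, z, Pi.add_apply, Finset.sum_apply]
    rw [H.sumAbove_right Z.1 e (by linarith)]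
    · congr 1
      refine Finset.sum_congr rfl fun f _ => ?_
      split_ifs <;> rfl
    · intro f
      refine ⟨fun h => ?_, fun h => by linarith⟩
      by_contra h'
      linarith [hss e f (not_le.1 h')]
    · exact fun f => ⟨fun h => by linarith, fun h => by linarith [hst e f h]⟩
  have hl' : ∀ v e, t e = v → l e = TL v + ∑ f with t f = v,
      if lineHeight (s e) (t e) (v.1 - δ) < lineHeight (s f) (t f) (v.1 - δ) then z f else 0 := by
    rintro _ e rfl
    ext Z
    have hlt := hst e e (H.lt e)
    have := H.sumAbove_eq Z.2 e (x := (s e).1 + δ) (x' := (t e).1 - δ) (by linarith) (by linarith)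
      (by linarith)
      (fun f => ⟨fun h => by linarith [hss e f (by linarith)],
        fun h => by linarith [hst e f (by linarith)]⟩)
      (fun f => ⟨fun h => by linarith [hst f e (by linarith)],
        fun h => by linarith [htt f e (by linarith)]⟩)
    simp only [l, TL, z, Pi.add_apply, Finset.sum_apply]
    rw [this, H.sumAbove_left Z.1 e (by linarith)]
    · congr 1
      refine Finset.sum_congr rfl fun f _ => ?_
      split_ifs <;> rfl
    · intro f
      refine ⟨fun h => ?_, fun h => by linarith⟩
      by_contra h'
      linarith [htt f e (not_le.1 h')]
    · exact fun f => ⟨fun h => by linarith, fun h => by linarith [hst f e h]⟩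
  -- The faces above and below `e` are parity functions on the cycles; crossing `e` downwards adds
  -- `z e`.
  refine ⟨Cyc → ZMod 2, l, fun e => l e + z e, fun Z => ⟨?_, fun hZ => ?_⟩⟩
  · rintro ⟨g, rfl⟩ p
    let G : E → ZMod 2 := fun e => g (l e) + g (l e + z e)
    -- Both sums telescope around `v`, between the same two labels: `hT` compares them above `v`,
    -- and `hz`, the cycle condition at `v`, below.
    have hv : ∀ v, ∑ e with s e = v, G e = ∑ e with t e = v, G e := by
      intro v
      have hR : ∑ e with s e = v, G e = g (TR v) + g (TR v + ∑ e with s e = v, z e) := by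
        rw [← sum_telescope _ (fun e => lineHeight (s e) (t e) (v.1 + δ))]
        · refine Finset.sum_congr rfl fun e he => ?_
          simp only [G]
          rw [hl v e (Finset.mem_filter.1 he).2]
        · intro e he f hf hef
          simp only [Finset.coe_filter, Finset.mem_univ, true_and, Set.mem_ofPred_eq] at he hf
          by_contra hne
          have h1 := hst e e (H.lt e)
          have h2 := hst f f (H.lt f)
          rw [he] at h1
          rw [hf] at h2
          exact H.ne e f _ hne (by rw [he]; linarith) (by linarith) (by rw [hf]; linarith)
            (by linarith) hef
      have hL : ∑ e with t e = v, G e = g (TL v) + g (TL v + ∑ e with t e = v, z e) := by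
        rw [← sum_telescope _ (fun e => lineHeight (s e) (t e) (v.1 - δ))]
        · refine Finset.sum_congr rfl fun e he => ?_
          simp only [G]
          rw [hl' v e (Finset.mem_filter.1 he).2]
        · intro e he f hf hef
          simp only [Finset.coe_filter, Finset.mem_univ, true_and, Set.mem_ofPred_eq] at he hf
          by_contra hne
          have h1 := hst e e (H.lt e)
          have h2 := hst f f (H.lt f)
          rw [he] at h1
          rw [hf] at h2
          exact H.ne e f _ hne (by linarith) (by rw [he]; linarith) (by linarith)
            (by rw [hf]; linarith) hef
      have hT : TR v = TL v := funext fun Z => H.sumAboveRight_eq_left Z.2 v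
      have hz : ∑ e with s e = v, z e = ∑ e with t e = v, z e := by
        ext Z
        rw [← zmod_two_add_eq_zero, ← Z.2 (fun w => if w = v then 1 else 0)]
        simp only [Finset.sum_apply, Finset.sum_filter, ← Finset.sum_add_distrib, coboundary, z]
        refine Finset.sum_congr rfl fun e _ => ?_
        split_ifs <;> simp [CharTwo.add_self_eq_zero]
      rw [hR, hL, hT, hz]
    have hW : ∀ w : E → ℝ × ℝ, (∀ e, w e ∈ Finset.univ.image s ∪ Finset.univ.image t) →
        ∑ e, G e * p (w e) = ∑ v ∈ Finset.univ.image s ∪ Finset.univ.image t,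
          (∑ e with w e = v, G e) * p v := by
      intro w hw
      rw [← Finset.sum_fiberwise_of_maps_to (g := w) (fun e _ => hw e)]
      refine Finset.sum_congr rfl fun v _ => ?_
      rw [Finset.sum_mul]
      exact Finset.sum_congr rfl fun e he => by rw [(Finset.mem_filter.1 he).2]
    change ∑ e, G e * (p (s e) + p (t e)) = 0
    simp only [mul_add, Finset.sum_add_distrib]
    rw [hW s (by simp), hW t (by simp)]
    simp only [hv]
    exact CharTwo.add_self_eq_zero _
  -- The potential of a cycle is evaluation at this cycle.
  · refine ⟨fun φ => φ ⟨Z, hZ⟩, ?_⟩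
    ext e
    change l e ⟨Z, hZ⟩ + (l e ⟨Z, hZ⟩ + Z e) = Z e
    rw [← add_assoc, CharTwo.add_self_eq_zero, zero_add]

/-! ### From polygonal drawings to straight segments -/

theorem polyline_add (c : ℕ → ℝ × ℝ) (i : ℕ) {θ : ℝ} (h0 : 0 ≤ θ) (h1 : θ < 1) :
    polyline c (i + θ) = AffineMap.lineMap (c i) (c (i + 1)) θ := by
  have : ⌊(i : ℝ) + θ⌋₊ = i := by
    rw [add_comm, Nat.floor_add_natCast h0, Nat.floor_eq_zero.2 h1, zero_add]
  rw [polyline, this, add_sub_cancel_left]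

theorem polyline_natCast (c : ℕ → ℝ × ℝ) (i : ℕ) : polyline c i = c i := by
  simpa using polyline_add c i le_rfl one_pos

theorem exists_nonvertical {E : Type*} [Finite E] (d : E → ℝ × ℝ) (hd : ∀ e, d e ≠ 0) :
    ∃ ε : ℝ, ∀ e, (d e).1 + ε * (d e).2 ≠ 0 := by
  obtain ⟨ε, hε⟩ := (Set.finite_range fun e => -(d e).1 / (d e).2).exists_notMem
  refine ⟨ε, fun e h => ?_⟩
  by_cases h2 : (d e).2 = 0
  · rw [h2, mul_zero, add_zero] at h
    exact hd e (Prod.ext h h2)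
  · exact hε ⟨e, by field_simp; linarith⟩

theorem lineMap_eq_lineHeight {a b : ℝ × ℝ} (h : a.1 < b.1) (x : ℝ) :
    AffineMap.lineMap a b ((x - a.1) / (b.1 - a.1)) = (x, lineHeight a b x) := by
  have : b.1 - a.1 ≠ 0 := (sub_pos.2 h).ne'
  ext
  · simp [AffineMap.lineMap_apply]; field_simp; ring
  · simp [AffineMap.lineMap_apply, lineHeight]; ring

/-- A multigraph that is drawn in the plane with straight edges has a Whitney dual. -/
theorem hasDual_of_segments {E : Type} [Fintype E] (a b : E → ℝ × ℝ) (hab : ∀ e, a e ≠ b e)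
    (h1 : ∀ e f (θ θ' : ℝ), e ≠ f → 0 < θ → θ < 1 → 0 < θ' → θ' < 1 →
      (AffineMap.lineMap (a e) (b e) θ : ℝ × ℝ) ≠ AffineMap.lineMap (a f) (b f) θ')
    (h2 : ∀ e f (θ : ℝ), 0 < θ → θ < 1 → (AffineMap.lineMap (a e) (b e) θ : ℝ × ℝ) ≠ a f ∧
      (AffineMap.lineMap (a e) (b e) θ : ℝ × ℝ) ≠ b f) : HasDual a b := by
  classical
  -- The shear `L` makes every edge non-vertical, after which edges can be directed to the right.
  obtain ⟨ε, hε⟩ := exists_nonvertical (fun e => b e - a e) (fun e => sub_ne_zero.2 (hab e).symm)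
  let L : ℝ × ℝ → ℝ × ℝ := fun z => (z.1 + ε * z.2, z.2)
  let L' : ℝ × ℝ → ℝ × ℝ := fun z => (z.1 - ε * z.2, z.2)
  have hL' : ∀ z, L' (L z) = z := fun z => by simp [L, L']
  have hL : Function.Injective L := Function.LeftInverse.injective hL'
  have hLm : ∀ (x y : ℝ × ℝ) (θ : ℝ), L (AffineMap.lineMap x y θ) =
      AffineMap.lineMap (L x) (L y) θ := by
    intro x y θ
    ext
    · simp [L, AffineMap.lineMap_apply]; ring
    · simp [L, AffineMap.lineMap_apply]
  let s : E → ℝ × ℝ := fun e => if (L (a e)).1 < (L (b e)).1 then L (a e) else L (b e)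
  let t : E → ℝ × ℝ := fun e => if (L (a e)).1 < (L (b e)).1 then L (b e) else L (a e)
  have hst : ∀ e, s e = L (a e) ∧ t e = L (b e) ∨ s e = L (b e) ∧ t e = L (a e) := by
    intro e
    by_cases h : (L (a e)).1 < (L (b e)).1
    · left; simp only [s, t, if_pos h]; simp
    · right; simp only [s, t, if_neg h]; simp
  have hlt : ∀ e, (s e).1 < (t e).1 := by
    intro e
    by_cases h : (L (a e)).1 < (L (b e)).1
    · simp only [s, t, if_pos h]; exact h
    · simp only [s, t, if_neg h]
      refine lt_of_le_of_ne (not_lt.1 h) fun h' => hε e ?_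
      simp only [L, Prod.fst_sub, Prod.snd_sub] at h' ⊢
      linarith
  have hpt : ∀ e x, (s e).1 < x → x < (t e).1 → ∃ θ : ℝ, 0 < θ ∧ θ < 1 ∧
      (x, lineHeight (s e) (t e) x) = L (AffineMap.lineMap (a e) (b e) θ) := by
    intro e x hx1 hx2
    have h0 := sub_pos.2 (hlt e)
    have h3 : 0 < (x - (s e).1) / ((t e).1 - (s e).1) := div_pos (by linarith) h0
    have h4 : (x - (s e).1) / ((t e).1 - (s e).1) < 1 := by rw [div_lt_one h0]; linarith
    rw [← lineMap_eq_lineHeight (hlt e)]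
    rcases hst e with h | h
    · exact ⟨_, h3, h4, by rw [hLm, h.1, h.2]⟩
    · refine ⟨1 - (x - (s e).1) / ((t e).1 - (s e).1), by linarith, by linarith, ?_⟩
      rw [hLm, AffineMap.lineMap_apply_one_sub, h.1, h.2]
  have H : IsStraightDrawing s t := by
    refine ⟨hlt, fun e f x hef hx1 hx2 hx3 hx4 h => ?_, fun e f hx1 hx2 h => ?_,
      fun e f hx1 hx2 h => ?_⟩
    · obtain ⟨θ, h3, h4, h5⟩ := hpt e x hx1 hx2
      obtain ⟨θ', h3', h4', h5'⟩ := hpt f x hx3 hx4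
      rw [h, h5'] at h5
      exact h1 e f θ θ' hef h3 h4 h3' h4' (hL h5.symm)
    · obtain ⟨θ, h3, h4, h5⟩ := hpt e _ hx1 hx2
      rw [h] at h5
      change s f = _ at h5
      rcases hst f with h' | h' <;> rw [h'.1] at h5
      · exact (h2 e f θ h3 h4).1 (hL h5.symm)
      · exact (h2 e f θ h3 h4).2 (hL h5.symm)
    · obtain ⟨θ, h3, h4, h5⟩ := hpt e _ hx1 hx2
      rw [h] at h5
      change t f = _ at h5
      rcases hst f with h' | h' <;> rw [h'.2] at h5
      · exact (h2 e f θ h3 h4).2 (hL h5.symm)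
      · exact (h2 e f θ h3 h4).1 (hL h5.symm)
  have hcob : ∀ p e, coboundary s t p e = coboundary a b (fun z => p (L z)) e := by
    intro p e
    simp only [coboundary]
    rcases hst e with h | h
    · rw [h.1, h.2]
    · rw [h.1, h.2, add_comm]
  refine H.hasDual.minor id Function.injective_id ∅ (by simp)
    (fun p _ => ⟨fun z => p (L z), fun e => hcob p e⟩)
    (fun q => ⟨fun z => q (L' z), by simp, fun e => ?_⟩)
  rw [id, hcob]
  simp only [hL']

theorem sigma_fin_ext {ι : Type*} {N : ι → ℕ} {x y : Σ e, Fin (N e)} (h : x.1 = y.1)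
    (h' : (x.2 : ℕ) = y.2) : x = y := by
  obtain ⟨e, i⟩ := x
  obtain ⟨f, j⟩ := y
  obtain rfl : e = f := h
  exact congrArg (Sigma.mk e) (Fin.ext h')

/-- A finite planar multigraph has a Whitney dual. -/
theorem Graph.IsPlanar.hasDual {α β : Type} {G : Graph α β} [Fintype G.edgeSet] (h : G.IsPlanar)
    (s t : G.edgeSet → G.vertexSet) (hst : ∀ e : G.edgeSet, G.IsLink e (s e) (t e)) :
    HasDual s t := by
  classical
  obtain ⟨pt, I, hpt, harc, hIv, hII⟩ := h
  choose N c hN hc0 hcN hinj _ hI using fun e : G.edgeSet => harc e (s e) (t e) (hst e)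
  have hmem : ∀ (e : G.edgeSet) (i : ℕ) (θ : ℝ), i < N e → 0 ≤ θ → θ < 1 →
      (i : ℝ) + θ ∈ Set.Ico (0 : ℝ) (N e) := by
    intro e i θ hi h0 h1
    have : (i : ℝ) + 1 ≤ N e := by exact_mod_cast hi
    exact ⟨by positivity, by linarith⟩
  have hinner : ∀ (e : G.edgeSet) (i : ℕ) (θ : ℝ), i < N e → 0 < θ → θ < 1 →
      AffineMap.lineMap (c e i) (c e (i + 1)) θ ∈ I e := by
    intro e i θ hi h0 h1
    rw [hI]
    exact ⟨i + θ, ⟨by positivity, (hmem e i θ hi h0.le h1).2⟩, polyline_add _ _ h0.le h1⟩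
  have hcorner : ∀ (e : G.edgeSet) (i : ℕ), 0 < i → i < N e → c e i ∈ I e := by
    intro e i h0 hi
    rw [hI]
    exact ⟨i, ⟨by exact_mod_cast h0, by exact_mod_cast hi⟩, polyline_natCast _ _⟩
  have hdisj : ∀ (e f : G.edgeSet) z, z ∈ I e → z ∈ I f → e = f := by
    intro e f z he hf
    by_contra hne
    exact Set.disjoint_left.1 (hII e e.2 f f.2 (fun h => hne (Subtype.ext h))) he hf
  have hvert : ∀ (e f : G.edgeSet) (j : ℕ), j ≤ N f → c f j ∈ I e → e = f ∧ 0 < j ∧ j < N f := by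
    intro e f j hj hin
    have h0 : j ≠ 0 := by
      rintro rfl
      rw [hc0] at hin
      exact hIv e e.2 _ (s f).2 hin
    have h1 : j ≠ N f := by
      rintro rfl
      rw [hcN] at hin
      exact hIv e e.2 _ (t f).2 hin
    exact ⟨hdisj e f _ hin (hcorner f j (by omega) (by omega)), by omega, by omega⟩
  have hoff : ∀ (e f : G.edgeSet) (i j : ℕ) (θ : ℝ), i < N e → 0 < θ → θ < 1 → j ≤ N f →
      AffineMap.lineMap (c e i) (c e (i + 1)) θ ≠ c f j := by
    intro e f i j θ hi h0 h1 hj heq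
    obtain ⟨rfl, h2, h3⟩ := hvert e f j hj (heq ▸ hinner e i θ hi h0 h1)
    rw [← polyline_add _ _ h0.le h1, ← polyline_natCast (c e) j] at heq
    have := hinj e (hmem e i θ hi h0.le h1) ⟨by positivity, by exact_mod_cast h3⟩ heq
    have h4 : i < j := by exact_mod_cast (show (i : ℝ) < j by linarith)
    have h5 : j < i + 1 := by exact_mod_cast (show (j : ℝ) < i + 1 by linarith)
    omega
  let a : (Σ e : G.edgeSet, Fin (N e)) → ℝ × ℝ := fun x => c x.1 x.2
  let b : (Σ e : G.edgeSet, Fin (N e)) → ℝ × ℝ := fun x => c x.1 (x.2 + 1)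
  have key : HasDual a b := by
    refine hasDual_of_segments a b ?_ ?_ ?_
    · rintro ⟨e, i⟩ h
      have h1 := polyline_add (c e) i (θ := 1 / 2) (by norm_num) (by norm_num)
      have h2 := polyline_add (c e) i (θ := 0) le_rfl (by norm_num)
      simp only [a, b] at h
      rw [← h, AffineMap.lineMap_same_apply] at h1 h2
      have := hinj e (hmem e i _ i.2 (by norm_num) (by norm_num))
        (hmem e i _ i.2 le_rfl (by norm_num)) (h1.trans h2.symm)
      norm_num at this
    · rintro ⟨e, i⟩ ⟨f, j⟩ θ θ' hne h0 h1 h0' h1' heq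
      simp only [a, b] at heq
      obtain rfl : e = f := hdisj e f _ (hinner e i θ i.2 h0 h1)
        (heq ▸ hinner f j θ' j.2 h0' h1')
      rw [← polyline_add _ _ h0.le h1, ← polyline_add _ _ h0'.le h1'] at heq
      have := hinj e (hmem e i θ i.2 h0.le h1) (hmem e j θ' j.2 h0'.le h1') heq
      have h4 : (i : ℕ) < j + 1 := by exact_mod_cast (show (i : ℝ) < j + 1 by linarith)
      have h5 : (j : ℕ) < i + 1 := by exact_mod_cast (show (j : ℝ) < i + 1 by linarith)
      exact hne (sigma_fin_ext rfl (by simp only; omega))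
    · rintro ⟨e, i⟩ ⟨f, j⟩ θ h0 h1
      exact ⟨hoff e f i j θ i.2 h0 h1 j.2.le, hoff e f i (j + 1) θ i.2 h0 h1 j.2⟩
  -- The segments form a subdivision of `G`. All segments of an edge but its first are contracted.
  refine key.minor (fun e => ⟨e, ⟨0, hN e⟩⟩) (fun e f h => congrArg Sigma.fst h)
    {x | (x.2 : ℕ) ≠ 0} (fun e h => h rfl) (fun p hp => ?_) (fun q => ?_)
  · refine ⟨fun v => p (pt v), fun e => ?_⟩
    have hstep : ∀ i, i < N e → p (c e 1) = p (c e (i + 1)) := by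
      intro i
      induction i with
      | zero => intro _; rfl
      | succ i ih =>
        intro hi
        rw [ih (by omega)]
        exact zmod_two_add_eq_zero.1 (hp ⟨e, ⟨i + 1, hi⟩⟩ (Nat.succ_ne_zero i))
    have h1 := hstep (N e - 1) (by have := hN e; omega)
    rw [Nat.sub_add_cancel (hN e), hcN] at h1
    simp only [coboundary, a, b, zero_add]
    rw [hc0, h1]
  · let p : ℝ × ℝ → ZMod 2 := fun z =>
      if h : ∃ v : G.vertexSet, pt v = z then q h.choose
      else if h : ∃ e : G.edgeSet, z ∈ I e then q (t h.choose) else 0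
    have hp1 : ∀ v : G.vertexSet, p (pt v) = q v := by
      intro v
      have h : ∃ w : G.vertexSet, pt w = pt v := ⟨v, rfl⟩
      simp only [p, dif_pos h]
      rw [Subtype.ext (hpt h.choose.2 v.2 h.choose_spec)]
    have hp2 : ∀ (e : G.edgeSet) z, z ∈ I e → p z = q (t e) := by
      intro e z hz
      have h : ¬ ∃ w : G.vertexSet, pt w = z := by
        rintro ⟨w, rfl⟩
        exact hIv e e.2 w w.2 hz
      have h' : ∃ e : G.edgeSet, z ∈ I e := ⟨e, hz⟩
      simp only [p, dif_neg h, dif_pos h']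
      rw [hdisj _ _ _ h'.choose_spec hz]
    have hp3 : ∀ (e : G.edgeSet) i, 0 < i → i ≤ N e → p (c e i) = q (t e) := by
      intro e i h0 hi
      rcases hi.lt_or_eq with hi | rfl
      · exact hp2 e _ (hcorner e i h0 hi)
      · rw [hcN, hp1]
    refine ⟨p, ?_, fun e => ?_⟩
    · rintro ⟨e, i⟩ hi
      simp only [coboundary, a, b]
      rw [hp3 e i (Nat.pos_of_ne_zero hi) i.2.le, hp3 e (i + 1) (Nat.succ_pos _) i.2,
        CharTwo.add_self_eq_zero]
    · simp only [coboundary, a, b]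
      rw [hc0, hp1, hp3 e _ (Nat.succ_pos _) (hN e)]

/-! ### Counting adjacent pairs, and connected components -/

open Classical in
/-- The truth value of a proposition as a natural number. -/
noncomputable def truthValue (p : Prop) : ℕ := if p then 1 else 0

theorem truthValue_of {p : Prop} (h : p) : truthValue p = 1 := if_pos h

theorem card_filter_eq_sum_truthValue {ι : Type*} (S : Finset ι) (p : ι → Prop)
    [DecidablePred p] : (S.filter p).card = ∑ x ∈ S, truthValue (p x) := by
  rw [Finset.card_filter]
  refine Finset.sum_congr rfl fun x _ => ?_
  unfold truthValue
  congr

/-- A form of `HasDual.card_pairs_le` in which the count splits when the index types are sums or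
options. -/
theorem HasDual.sum_touching_le {E V A B : Type*} [Fintype E] [Fintype A] [Fintype B]
    {s t : E → V} (H : HasDual s t) {adj : V → V → Prop}
    (hadj : ∀ u v, adj u v → ∃ e, s e = u ∧ t e = v ∨ s e = v ∧ t e = u)
    (f : A ⊕ B → Set V) (hf : ∀ w w' v, v ∈ f w → v ∈ f w' → w = w')
    (hc : ∀ w, ConnectedSet adj (f w)) (h3 : 3 ≤ Fintype.card A + Fintype.card B) :
    (∑ a : A, ∑ b : B, truthValue (∃ u ∈ f (.inl a), ∃ v ∈ f (.inr b), adj u v)) + 4 ≤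
      2 * (Fintype.card A + Fintype.card B) := by
  classical
  refine le_trans (le_of_eq ?_) (H.card_pairs_le hadj f hf hc (Finset.univ.filter fun x : A × B =>
    ∃ u ∈ f (.inl x.1), ∃ v ∈ f (.inr x.2), adj u v)
    (fun a b hab => (Finset.mem_filter.1 hab).2) h3)
  rw [card_filter_eq_sum_truthValue, Fintype.sum_prod_type]

theorem connectedSet_singleton {V : Type*} (adj : V → V → Prop) (v : V) :
    ConnectedSet adj {v} := by
  rintro p - u rfl w rfl
  rfl

/-- The decomposition of a vertex set into connected components. -/
theorem exists_components {V : Type*} (adj : V → V → Prop) (S : Finset V) :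
    ∃ J : Finset (Finset V), (∀ D ∈ J, D ⊆ S ∧ D.Nonempty ∧ ConnectedSet adj (D : Set V)) ∧
      (∀ D ∈ J, ∀ D' ∈ J, ∀ v, v ∈ D → v ∈ D' → D = D') ∧ (∀ v ∈ S, ∃ D ∈ J, v ∈ D) ∧
      ∀ D ∈ J, ∀ u ∈ D, ∀ v ∈ S, adj u v → v ∈ D := by
  classical
  let r : V → V → Prop := fun u v => u ∈ S ∧ v ∈ S ∧ adj u v
  let κ : V → Quot r := Quot.mk r
  refine ⟨S.image fun v => S.filter fun u => κ u = κ v, ?_, ?_, ?_, ?_⟩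
  · intro D hD
    obtain ⟨v, hv, rfl⟩ := Finset.mem_image.1 hD
    refine ⟨Finset.filter_subset _ _, ⟨v, by simp [hv]⟩, fun p hp u hu w hw => ?_⟩
    simp only [Finset.coe_filter, Set.mem_ofPred_eq] at hu hw hp
    have key : ∀ a b, Relation.EqvGen r a b → κ a = κ v → p a = p b := by
      intro a b hab
      induction hab with
      | rel a b h =>
        intro ha
        have : κ a = κ b := Quot.sound h
        exact hp a ⟨h.1, ha⟩ b ⟨h.2.1, this ▸ ha⟩ h.2.2
      | refl a => exact fun _ => rfl
      | symm a b hab ih => exact fun hb => (ih ((Quot.eqvGen_sound hab).trans hb)).symm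
      | trans a b c hab hbc ih ih' =>
        exact fun ha => (ih ha).trans (ih' ((Quot.eqvGen_sound hab).symm.trans ha))
    exact key u w (Quot.eqvGen_exact (hu.2.trans hw.2.symm)) hu.2
  · intro D hD D' hD' v hv hv'
    obtain ⟨a, -, rfl⟩ := Finset.mem_image.1 hD
    obtain ⟨b, -, rfl⟩ := Finset.mem_image.1 hD'
    rw [← (Finset.mem_filter.1 hv).2, ← (Finset.mem_filter.1 hv').2]
  · exact fun v hv => ⟨_, Finset.mem_image_of_mem _ hv, by simp [hv]⟩
  · intro D hD u hu v hv huv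
    obtain ⟨a, -, rfl⟩ := Finset.mem_image.1 hD
    rw [Finset.mem_filter] at hu ⊢
    exact ⟨hv, (Quot.sound (r := r) ⟨hu.1, hv, huv⟩).symm.trans hu.2⟩

/-! ### The isoperimetric inequality for patches -/

section Patch

variable {V : Type*} [Fintype V]

open Classical in
/-- The vertices outside of `C` with a neighbour in `C`. -/
noncomputable def outerBoundary (adj : V → V → Prop) (C : Finset V) : Finset V :=
  Finset.univ.filter fun v => v ∉ C ∧ ∃ u ∈ C, adj u v

open Classical in
/-- The number of adjacent pairs consisting of a vertex in `C` and a vertex outside of `C`. -/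
noncomputable def leavingCount (adj : V → V → Prop) (C : Finset V) : ℕ :=
  ∑ u ∈ C, ((outerBoundary adj C).filter (adj u)).card

open Classical in
/-- A patch: a set `C` of vertices of degree at least four in which adjacent vertices have
different colours, all vertices of its outer boundary having the same colour and being adjacent to
a connected hub. -/
structure IsPatch (adj : V → V → Prop) (P H : Set V) (C : Finset V) : Prop where
  nonempty : C.Nonempty
  hub_connected : ConnectedSet adj H
  hub_disjoint : ∀ v ∈ H, v ∉ C ∧ v ∉ outerBoundary adj C
  outer_mem : ∀ v ∈ outerBoundary adj C, v ∈ P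
  colour : ∀ u ∈ C, ∀ v, adj u v → (u ∈ P ↔ v ∉ P)
  outer_nonempty : ∀ D ⊆ C, D.Nonempty → (outerBoundary adj D).Nonempty
  four_le_deg : ∀ u ∈ C, 4 ≤ (Finset.univ.filter (adj u)).card
  outer_hub : ∀ u ∈ outerBoundary adj C, ∃ w ∈ H, adj u w

theorem mem_outerBoundary {adj : V → V → Prop} {C : Finset V} {v : V} :
    v ∈ outerBoundary adj C ↔ v ∉ C ∧ ∃ u ∈ C, adj u v := by simp [outerBoundary]

/-- The size of a patch is bounded in terms of the size of its outer boundary. -/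
theorem IsPatch.bound {E : Type*} [Fintype E] {s t : E → V} (hdual : HasDual s t)
    {adj : V → V → Prop} (hsymm : ∀ u v, adj u v → adj v u)
    (hadj : ∀ u v, adj u v → ∃ e, s e = u ∧ t e = v ∨ s e = v ∧ t e = u)
    (C : Finset V) (P H : Set V) (hC : IsPatch adj P H C) :
    leavingCount adj C + 4 ≤ 2 * (outerBoundary adj C).card ∧
      C.card ≤ ((outerBoundary adj C).card - 2) ^ 2 := by
  classical
  induction C using Finset.strongInduction generalizing P H with
  | H C ih =>
  set X := outerBoundary adj C with hX
  let T := C.filter fun u => ∃ v ∉ C, adj u v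
  have hTC : T ⊆ C := Finset.filter_subset _ _
  have hTX : ∀ u ∈ T, ∃ v ∈ X, adj u v := fun u hu => by
    obtain ⟨h1, v, hv, huv⟩ := Finset.mem_filter.1 hu
    exact ⟨v, mem_outerBoundary.2 ⟨hv, u, h1, huv⟩, huv⟩
  have hXT : ∀ v ∈ X, ∃ u ∈ T, adj u v := fun v hv => by
    obtain ⟨h1, u, hu, huv⟩ := mem_outerBoundary.1 hv
    exact ⟨u, Finset.mem_filter.2 ⟨hu, v, h1, huv⟩, huv⟩
  have hXC : ∀ v ∈ X, v ∉ C := fun v hv => (mem_outerBoundary.1 hv).1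
  have hTP : ∀ u ∈ T, u ∉ P := fun u hu h => by
    obtain ⟨v, hv, huv⟩ := hTX u hu
    exact (hC.colour u (hTC hu) v huv).1 h (hC.outer_mem v hv)
  obtain ⟨v₀, hv₀⟩ := hC.outer_nonempty C subset_rfl hC.nonempty
  obtain ⟨u₀, hu₀, -⟩ := hXT v₀ hv₀
  obtain ⟨J, hJ, hJd, hJc, hJa⟩ := exists_components adj (C \ T)
  have hDC : ∀ D ∈ J, ∀ v ∈ D, v ∈ C ∧ v ∉ T := fun D hD v hv =>
    Finset.mem_sdiff.1 ((hJ D hD).1 hv)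
  have hDT : ∀ D ∈ J, ∀ v, v ∈ outerBoundary adj D ↔ v ∈ T ∧ ∃ u ∈ D, adj u v := by
    intro D hD v
    rw [mem_outerBoundary]
    refine ⟨fun ⟨h1, u, hu, huv⟩ => ⟨?_, u, hu, huv⟩, fun ⟨h1, h2⟩ =>
      ⟨fun h => (hDC D hD v h).2 h1, h2⟩⟩
    obtain ⟨h2, h3⟩ := hDC D hD u hu
    by_contra h4
    have h5 : v ∈ C := by
      by_contra h5
      exact h3 (Finset.mem_filter.2 ⟨h2, v, h5, huv⟩)
    exact h1 (hJa D hD u hu v (Finset.mem_sdiff.2 ⟨h5, h4⟩) huv)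
  have hHc : ConnectedSet adj (H ∪ X) := by
    intro p hp
    have h1 := hC.hub_connected p fun u hu v hv => hp u (Or.inl hu) v (Or.inl hv)
    have h2 : ∀ u ∈ H ∪ (X : Set V), ∃ w ∈ H, p u = p w := by
      rintro u (hu | hu)
      · exact ⟨u, hu, rfl⟩
      · obtain ⟨w, hw, huw⟩ := hC.outer_hub u hu
        exact ⟨w, hw, hp u (Or.inr hu) w (Or.inl hw) huw⟩
    intro u hu v hv
    obtain ⟨w, hw, h3⟩ := h2 u hu
    obtain ⟨w', hw', h4⟩ := h2 v hv
    rw [h3, h4, h1 w hw w' hw']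
  -- The colours swap: the outer boundary of `D` lies in `T`, outside of `P`, and `X` joins the hub.
  have hpatch : ∀ D ∈ J, IsPatch adj Pᶜ (H ∪ X) D := by
    intro D hD
    refine ⟨(hJ D hD).2.1, hHc, ?_, ?_, ?_, ?_, ?_, ?_⟩
    · intro v hv
      have h1 : v ∉ C := by
        rcases hv with hv | hv
        · exact (hC.hub_disjoint v hv).1
        · exact hXC v hv
      exact ⟨fun h => h1 (hDC D hD v h).1, fun h => h1 (hTC ((hDT D hD v).1 h).1)⟩
    · exact fun v hv => hTP v ((hDT D hD v).1 hv).1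
    · intro u hu v huv
      have := hC.colour u (hDC D hD u hu).1 v huv
      simp only [Set.mem_compl_iff]
      tauto
    · exact fun D' hD' => hC.outer_nonempty D' fun v hv => (hDC D hD v (hD' hv)).1
    · exact fun u hu => hC.four_le_deg u (hDC D hD u hu).1
    · intro u hu
      obtain ⟨v, hv, huv⟩ := hTX u ((hDT D hD u).1 hu).1
      exact ⟨v, Or.inr hv, huv⟩
  have hlt : ∀ D ∈ J, D ⊂ C := fun D hD =>
    ⟨fun v hv => (hDC D hD v hv).1, fun h => (hDC D hD u₀ (h (hTC hu₀))).2 hu₀⟩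
  have hind := fun D hD => ih D (hlt D hD) Pᶜ (H ∪ X) (hpatch D hD)
  have hout : ∀ D ∈ J, (∑ u ∈ T, truthValue (∃ v ∈ D, adj u v)) =
      (outerBoundary adj D).card := by
    intro D hD
    rw [← card_filter_eq_sum_truthValue]
    congr 1
    ext v
    rw [Finset.mem_filter, hDT D hD]
    refine and_congr_right fun _ => exists_congr fun u => and_congr_right fun _ => ?_
    exact ⟨hsymm _ _, hsymm _ _⟩
  have hleave : leavingCount adj C = ∑ u ∈ T, (X.filter (adj u)).card := by
    symm
    refine Finset.sum_subset hTC fun u hu hu' => ?_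
    rw [Finset.card_eq_zero, Finset.filter_eq_empty_iff]
    exact fun v hv huv => hu' (Finset.mem_filter.2 ⟨hu, v, hXC v hv, huv⟩)
  -- Euler's inequality for the bipartite minor with parts hub and `T`, against `X` and the
  -- components. Pairs of hub and component only add to the left side and are discarded.
  have euler1 : X.card + leavingCount adj C + ∑ D ∈ J, (outerBoundary adj D).card + 4 ≤
      2 * (1 + T.card + X.card + J.card) := by
    let f : Option T ⊕ (X ⊕ J) → Set V := fun w => match w with
      | .inl none => H
      | .inl (some u) => {u.1}
      | .inr (.inl v) => {v.1}
      | .inr (.inr D) => (D.1 : Set V)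
    have h := hdual.sum_touching_le hadj f ?_ ?_ ?_
    · simp only [Fintype.sum_option, Fintype.sum_sum_type, Fintype.card_option, Fintype.card_sum,
        Fintype.card_coe, f, Set.mem_singleton_iff, exists_eq_left, Finset.mem_coe,
        Finset.sum_add_distrib] at h
      have e1 : ∑ v : X, truthValue (∃ u ∈ H, adj u v) = X.card := by
        rw [Finset.sum_congr rfl fun v _ => truthValue_of ?_, Finset.sum_const, smul_eq_mul, mul_one,
          Finset.card_univ, Fintype.card_coe]
        obtain ⟨w, hw, h⟩ := hC.outer_hub v.1 v.2
        exact ⟨w, hw, hsymm _ _ h⟩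
      have e2 : ∑ u : T, ∑ v : X, truthValue (adj u v) = leavingCount adj C := by
        rw [hleave, ← Finset.sum_coe_sort T fun u => (X.filter (adj u)).card]
        refine Finset.sum_congr rfl fun u _ => ?_
        rw [card_filter_eq_sum_truthValue]
        exact Finset.sum_coe_sort X fun v => truthValue (adj u v)
      have e3 : ∑ u : T, ∑ D : J, truthValue (∃ v ∈ D.1, adj u v) =
          ∑ D ∈ J, (outerBoundary adj D).card := by
        rw [Finset.sum_comm, ← Finset.sum_coe_sort J fun D => (outerBoundary adj D).card]
        refine Finset.sum_congr rfl fun D _ => ?_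
        rw [← hout D.1 D.2]
        exact Finset.sum_coe_sort T fun u => truthValue (∃ v ∈ D.1, adj u v)
      omega
    · rintro ((_ | u) | v | D) ((_ | u') | v' | D') w hw hw' <;>
        simp only [f, Set.mem_singleton_iff, Finset.mem_coe] at hw hw' <;>
        (try subst hw) <;> (try subst hw')
      · rfl
      · exact absurd (hTC u'.2) (hC.hub_disjoint _ hw).1
      · exact absurd v'.2 (hC.hub_disjoint _ hw).2
      · exact absurd (hDC _ D'.2 _ hw').1 (hC.hub_disjoint _ hw).1
      · exact absurd (hTC u.2) (hC.hub_disjoint _ hw').1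
      · rw [Subtype.ext hw']
      · exact absurd (hTC u.2) (hw' ▸ hXC _ v'.2)
      · exact absurd u.2 (hDC _ D'.2 _ hw').2
      · exact absurd v.2 (hC.hub_disjoint _ hw').2
      · exact absurd (hTC u'.2) (hw' ▸ hXC _ v.2)
      · rw [Subtype.ext hw']
      · exact absurd (hDC _ D'.2 _ hw').1 (hXC _ v.2)
      · exact absurd (hDC _ D.2 _ hw).1 (hC.hub_disjoint _ hw').1
      · exact absurd u'.2 (hDC _ D.2 _ hw).2
      · exact absurd (hDC _ D.2 _ hw).1 (hXC _ v'.2)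
      · rw [Subtype.ext (hJd _ D.2 _ D'.2 _ hw hw')]
    · rintro ((_ | u) | v | D)
      · exact hC.hub_connected
      · exact connectedSet_singleton _ _
      · exact connectedSet_singleton _ _
      · exact (hJ D.1 D.2).2.2
    · simp only [Fintype.card_option, Fintype.card_sum, Fintype.card_coe]
      have := Finset.card_pos.2 ⟨u₀, hu₀⟩
      have := Finset.card_pos.2 (⟨v₀, hv₀⟩ : X.Nonempty)
      omega
  -- The same with `X` contracted into the hub: `T` against the enlarged hub and the components. A
  -- component is needed to have at least three vertices.
  have euler2 : J.Nonempty → T.card + ∑ D ∈ J, (outerBoundary adj D).card + 4 ≤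
      2 * (T.card + J.card + 1) := by
    intro hJn
    let f : T ⊕ Option J → Set V := fun w => match w with
      | .inl u => {u.1}
      | .inr none => H ∪ X
      | .inr (some D) => (D.1 : Set V)
    have h := hdual.sum_touching_le hadj f ?_ ?_ ?_
    · simp only [Fintype.sum_option, Fintype.card_option, Fintype.card_coe, f,
        Set.mem_singleton_iff, exists_eq_left, Finset.mem_coe, Finset.sum_add_distrib] at h
      have e1 : ∑ u : T, truthValue (∃ v ∈ H ∪ (X : Set V), adj u v) = T.card := by
        rw [Finset.sum_congr rfl fun v _ => truthValue_of ?_, Finset.sum_const, smul_eq_mul, mul_one,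
          Finset.card_univ, Fintype.card_coe]
        obtain ⟨w, hw, h⟩ := hTX v.1 v.2
        exact ⟨w, Or.inr hw, h⟩
      have e3 : ∑ u : T, ∑ D : J, truthValue (∃ v ∈ D.1, adj u v) =
          ∑ D ∈ J, (outerBoundary adj D).card := by
        rw [Finset.sum_comm, ← Finset.sum_coe_sort J fun D => (outerBoundary adj D).card]
        refine Finset.sum_congr rfl fun D _ => ?_
        rw [← hout D.1 D.2]
        exact Finset.sum_coe_sort T fun u => truthValue (∃ v ∈ D.1, adj u v)
      omega
    · have hHX : ∀ v ∈ H ∪ (X : Set V), v ∉ C := by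
        rintro v (hv | hv)
        · exact (hC.hub_disjoint v hv).1
        · exact hXC v hv
      rintro (u | _ | D) (u' | _ | D') w hw hw' <;>
        simp only [f, Set.mem_singleton_iff, Finset.mem_coe] at hw hw' <;>
        (try subst hw) <;> (try subst hw')
      · rw [Subtype.ext hw']
      · exact absurd (hTC u.2) (hHX _ hw')
      · exact absurd u.2 (hDC _ D'.2 _ hw').2
      · exact absurd (hTC u'.2) (hHX _ hw)
      · rfl
      · exact absurd (hDC _ D'.2 _ hw').1 (hHX _ hw)
      · exact absurd u'.2 (hDC _ D.2 _ hw).2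
      · exact absurd (hDC _ D.2 _ hw).1 (hHX _ hw')
      · rw [Subtype.ext (hJd _ D.2 _ D'.2 _ hw hw')]
    · rintro (u | _ | D)
      · exact connectedSet_singleton _ _
      · exact hHc
      · exact (hJ D.1 D.2).2.2
    · simp only [Fintype.card_option, Fintype.card_coe]
      have := Finset.card_pos.2 ⟨u₀, hu₀⟩
      have := Finset.card_pos.2 hJn
      omega
  -- `T` is independent, so all neighbours of its vertices lie in `X` or in the components.
  have hdeg : 4 * T.card ≤ leavingCount adj C + ∑ D ∈ J, leavingCount adj D := by
    have h1 : ∀ u ∈ T, 4 ≤ (X.filter (adj u)).card + ∑ D ∈ J, (D.filter (adj u)).card := by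
      intro u hu
      refine (hC.four_le_deg u (hTC hu)).trans (le_trans (Finset.card_le_card
        (t := X.filter (adj u) ∪ J.biUnion fun D => D.filter (adj u)) ?_)
        ((Finset.card_union_le _ _).trans (add_le_add_right Finset.card_biUnion_le _)))
      intro v hv
      have huv := (Finset.mem_filter.1 hv).2
      rw [Finset.mem_union, Finset.mem_filter, Finset.mem_biUnion]
      by_cases hvC : v ∈ C
      · right
        have hvT : v ∉ T := fun hvT =>
          hTP u hu ((hC.colour u (hTC hu) v huv).2 (hTP v hvT))
        obtain ⟨D, hD, hvD⟩ := hJc v (Finset.mem_sdiff.2 ⟨hvC, hvT⟩)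
        exact ⟨D, hD, Finset.mem_filter.2 ⟨hvD, huv⟩⟩
      · exact Or.inl ⟨mem_outerBoundary.2 ⟨hvC, u, hTC hu, huv⟩, huv⟩
    have h2 : ∀ D ∈ J, ∑ u ∈ T, (D.filter (adj u)).card ≤ leavingCount adj D := by
      intro D hD
      simp only [leavingCount, Finset.card_filter]
      rw [Finset.sum_comm]
      refine Finset.sum_le_sum fun v hv => ?_
      rw [← Finset.card_filter, ← Finset.card_filter]
      refine Finset.card_le_card fun u hu => ?_
      obtain ⟨hu1, hu2⟩ := Finset.mem_filter.1 hu
      exact Finset.mem_filter.2 ⟨(hDT D hD u).2 ⟨hu1, v, hv, hsymm _ _ hu2⟩, hsymm _ _ hu2⟩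
    have h3 := Finset.card_nsmul_le_sum T _ 4 h1
    rw [Finset.sum_add_distrib, Finset.sum_comm, ← hleave, smul_eq_mul] at h3
    have h4 := Finset.sum_le_sum h2
    omega
  have hsum : ∑ D ∈ J, leavingCount adj D + 4 * J.card ≤
      2 * ∑ D ∈ J, (outerBoundary adj D).card := by
    rw [Finset.mul_sum, mul_comm, ← smul_eq_mul, ← Finset.sum_const, ← Finset.sum_add_distrib]
    exact Finset.sum_le_sum fun D hD => (hind D hD).1
  -- In twice `euler1` combined with `hdeg` and `hsum`, the terms in `T`, `J` and the boundaries of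
  -- the components cancel.
  have hfirst : leavingCount adj C + 4 ≤ 2 * X.card := by omega
  refine ⟨hfirst, ?_⟩
  have hcard : C.card ≤ T.card + ∑ D ∈ J, D.card := by
    refine le_trans (Finset.card_le_card (t := T ∪ J.biUnion id) fun v hv => ?_)
      ((Finset.card_union_le _ _).trans (add_le_add_right Finset.card_biUnion_le _))
    by_cases hvT : v ∈ T
    · exact Finset.mem_union_left _ hvT
    · obtain ⟨D, hD, hvD⟩ := hJc v (Finset.mem_sdiff.2 ⟨hv, hvT⟩)
      exact Finset.mem_union_right _ (Finset.mem_biUnion.2 ⟨D, hD, hvD⟩)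
  set z : Finset V → ℕ := fun D => (outerBoundary adj D).card - 2 with hz
  have hzsum : ∑ D ∈ J, (outerBoundary adj D).card = ∑ D ∈ J, z D + 2 * J.card := by
    rw [mul_comm, ← smul_eq_mul, ← Finset.sum_const, ← Finset.sum_add_distrib]
    refine Finset.sum_congr rfl fun D hD => ?_
    have := (hind D hD).1
    simp only [hz]
    omega
  have hsq : ∑ D ∈ J, D.card ≤ (∑ D ∈ J, z D) ^ 2 := by
    rw [pow_two, Finset.sum_mul]
    refine Finset.sum_le_sum fun D hD => ((hind D hD).2).trans ?_
    rw [pow_two]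
    exact Nat.mul_le_mul_left _ (Finset.single_le_sum (f := z) (fun _ _ => Nat.zero_le _) hD)
  obtain ⟨x, hx⟩ : ∃ x, X.card = x + 2 := ⟨X.card - 2, by omega⟩
  rw [hx, Nat.add_sub_cancel]
  rcases J.eq_empty_or_nonempty with hJ0 | hJn
  · rw [hJ0] at hdeg hcard
    simp only [Finset.sum_empty, add_zero] at hdeg hcard
    have : T.card ≤ x := by omega
    nlinarith
  · have h2 := euler2 hJn
    have h3 : ∑ D ∈ J, z D + 2 ≤ T.card := by omega
    -- The count `hdeg` gives `4|T| ≤ 2x + 2∑ z D`, and `∑ z D ≤ |T| - 2`. Then `|C| ≤ |T| + (|T| -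
    -- 2)² ≤ x²`.
    have h4 : T.card + 2 ≤ x := by omega
    nlinarith

end Patch

/-! ### Inner vertices of reduced bilabelled graphs -/

namespace BilabelledGraph

variable {k l : ℕ}

theorem exists_boundary_eq_input (K : BilabelledGraph k l) (i : Fin k) :
    ∃ j, K.boundary j = K.input i :=
  ⟨Fin.castAdd l i.rev, by rw [boundary, Fin.append_left, Fin.rev_rev]⟩

theorem exists_boundary_eq_output (K : BilabelledGraph k l) (i : Fin l) :
    ∃ j, K.boundary j = K.output i :=
  ⟨Fin.natAdd k i, by rw [boundary, Fin.append_right]⟩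

theorem boundary_induction (K : BilabelledGraph k l) {p : K.graph.vertexSet → Prop}
    (h : ∀ i, p (K.input i)) (h' : ∀ i, p (K.output i)) (j : Fin (k + l)) : p (K.boundary j) := by
  induction j using Fin.addCases with
  | left i => rw [boundary, Fin.append_left]; exact h _
  | right i => rw [boundary, Fin.append_right]; exact h' _

theorem finite_hubEnvelope_vertexSet (K : BilabelledGraph k l) :
    K.hubEnvelope.vertexSet.Finite := by
  refine ((((K.finite_vertexSet.image Sum.inl).union
    (Set.finite_range (Sum.inr : Fin (k + l) → K.α ⊕ Fin (k + l)))).image some).insert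
      none).subset ?_
  rintro (_ | x | i) hx
  · exact Or.inl rfl
  · exact Or.inr ⟨_, Or.inl ⟨x, hx _ rfl x rfl, rfl⟩, rfl⟩
  · exact Or.inr ⟨_, Or.inr ⟨i, rfl⟩, rfl⟩

theorem finite_hubEnvelope_edgeSet (K : BilabelledGraph k l) : K.hubEnvelope.edgeSet.Finite := by
  refine ((((K.finite_edgeSet.image Sum.inl).union (Set.finite_range
    (Sum.inr : _ → K.β ⊕ (Fin (k + l) ⊕ Fin (k + l))))).image Sum.inl).union
      (Set.finite_range Sum.inr)).subset ?_
  rintro ((e | i) | i) he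
  · obtain ⟨x, y, h⟩ := Graph.exists_isLink_of_mem_edgeSet he
    refine Or.inl ⟨_, Or.inl ⟨e, ?_, rfl⟩, rfl⟩
    rcases x with _ | x | x <;> rcases y with _ | y | y <;>
      first
      | exact Graph.IsLink.edge_mem (G := K.graph) h
      | exact False.elim h
  · exact Or.inl ⟨_, Or.inr ⟨i, rfl⟩, rfl⟩
  · exact Or.inr ⟨i, rfl⟩

/-- The neighbours in `K^⊙` of a vertex of `K` that is neither an input nor an output vertex. -/
theorem hubEnvelope_adj_iff (K : BilabelledGraph k l) {x : K.α}
    (hx : ∀ i, (K.boundary i : K.α) ≠ x) (w : Option (K.α ⊕ Fin (k + l))) :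
    K.hubEnvelope.Adj (some (.inl x)) w ↔ ∃ y, w = some (.inl y) ∧ K.graph.Adj x y := by
  constructor
  · rintro ⟨(e | i | i) | i, h⟩
    · rcases w with _ | y | y
      · exact False.elim h
      · exact ⟨y, rfl, e, h⟩
      · exact False.elim h
    · rcases w with _ | w
      · exact False.elim h
      · rcases Sym2.eq_iff.1 (show s(_, _) = s(_, _) from h) with h' | h'
        · exact absurd (Sum.inl.inj h'.1).symm (hx i)
        · exact absurd h'.1 (by simp)
    · rcases w with _ | w
      · exact False.elim h
      · rcases Sym2.eq_iff.1 (show s(_, _) = s(_, _) from h) with h' | h' <;>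
          exact absurd h'.1 (by simp)
    · rcases Sym2.eq_iff.1 (show s(_, _) = s(_, _) from h) with h' | h' <;>
        exact absurd h'.1 (by simp)
  · rintro ⟨y, rfl, e, h⟩
    exact ⟨.inl (.inl e), h⟩

theorem envelope_incidenceSet (K : BilabelledGraph k l) {x : K.α}
    (hx : ∀ i, (K.boundary i : K.α) ≠ x) :
    K.envelope.incidenceSet (.inl x) = Sum.inl '' K.graph.incidenceSet x := by
  ext e
  constructor
  · rintro ⟨w, h⟩
    rcases e with e | i | i
    · rcases w with y | y
      · exact ⟨e, ⟨y, h⟩, rfl⟩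
      · exact False.elim h
    · rcases Sym2.eq_iff.1 (show s(_, _) = s(_, _) from h) with h' | h'
      · exact absurd (Sum.inl.inj h'.1).symm (hx i)
      · exact absurd h'.1 (by simp)
    · rcases Sym2.eq_iff.1 (show s(_, _) = s(_, _) from h) with h' | h' <;>
        exact absurd h'.1 (by simp)
  · rintro ⟨e, ⟨y, h⟩, rfl⟩
    exact ⟨.inl y, h⟩

theorem IsReduced.reaches_boundary {K : BilabelledGraph k l} (hK : K.IsReduced) {x : K.α}
    (hx : x ∈ K.graph.vertexSet) : ∃ j, Relation.ReflTransGen K.graph.Adj x (K.boundary j) := by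
  rcases hK.component x hx with ⟨i, h⟩ | ⟨i, h⟩
  · obtain ⟨j, hj⟩ := K.exists_boundary_eq_input i
    exact ⟨j, hj ▸ h⟩
  · obtain ⟨j, hj⟩ := K.exists_boundary_eq_output i
    exact ⟨j, hj ▸ h⟩

theorem IsReduced.not_isLink_self {K : BilabelledGraph k l} (hK : K.IsReduced) (e : K.β)
    (x : K.α) : ¬ K.graph.IsLink e x x := by
  intro h
  obtain ⟨P, hP, -⟩ := hK.bipartite
  have := hP e x x h
  tauto

/-- A vertex that is neither an input nor an output vertex has at least four edges. -/
theorem IsReduced.four_le_incidenceSet {K : BilabelledGraph k l} (hK : K.IsReduced) {x : K.α}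
    (hx : x ∈ K.graph.vertexSet) (hxb : ∀ i, (K.boundary i : K.α) ≠ x) :
    4 ≤ (K.graph.incidenceSet x).ncard := by
  have hl : K.graph.loopSet x = ∅ :=
    Set.eq_empty_of_forall_notMem fun e he => hK.not_isLink_self e x he
  have hl' : K.envelope.loopSet (.inl x) = ∅ :=
    Set.eq_empty_of_forall_notMem fun e he => by
      have : e ∈ K.envelope.incidenceSet (.inl x) := ⟨_, he⟩
      rw [K.envelope_incidenceSet hxb] at this
      obtain ⟨e, -, rfl⟩ := this
      exact hK.not_isLink_self e x he
  have hd : K.deg x = (K.graph.incidenceSet x).ncard := by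
    rw [deg, Graph.deg, hl, Set.ncard_empty, add_zero]
  have hd' : K.extDeg x = (K.graph.incidenceSet x).ncard := by
    rw [extDeg, Graph.deg, hl', Set.ncard_empty, add_zero, K.envelope_incidenceSet hxb,
      Set.ncard_image_of_injective _ Sum.inl_injective]
  have h2 : (K.graph.incidenceSet x).ncard ≠ 2 := fun h =>
    hK.no_inner_deg_two ⟨x, hx, hd.trans h, hd'.trans h⟩
  obtain ⟨m, hm⟩ := hK.even_extDeg x hx
  rw [hd'] at hm
  have h0 : 0 < (K.graph.incidenceSet x).ncard := by
    rw [Set.ncard_pos (K.finite_edgeSet.subset (K.graph.incidenceSet_subset_edgeSet x))]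
    obtain ⟨j, hj⟩ := hK.reaches_boundary hx
    rcases hj.cases_head with h | ⟨y, ⟨e, h⟩, -⟩
    · exact absurd h.symm (hxb j)
    · exact ⟨e, y, h⟩
  omega

/-- The inner vertices form a patch in `K^⊙` whose outer boundary consists of input and output
vertices, at most `k + l` in number. The strings attach these to the hub. -/
theorem IsReduced.ncard_vertexSet_le {K : BilabelledGraph k l} (hK : K.IsReduced) :
    Nat.card K.graph.vertexSet ≤ (k + l) ^ 2 + (k + l) := by
  classical
  have := K.finite_hubEnvelope_vertexSet.fintype
  have := K.finite_hubEnvelope_edgeSet.fintype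
  have := K.finite_vertexSet.fintype
  let V := K.hubEnvelope.vertexSet
  let inner : K.graph.vertexSet → V := fun x =>
    ⟨some (.inl x), by rintro _ ⟨⟩ _ ⟨⟩; exact x.2⟩
  have hends : ∀ e : K.hubEnvelope.edgeSet, ∃ x y : V, K.hubEnvelope.IsLink e x y := by
    intro e
    obtain ⟨x, y, h⟩ := Graph.exists_isLink_of_mem_edgeSet e.2
    exact ⟨⟨x, h.left_mem⟩, ⟨y, h.right_mem⟩, h⟩
  choose s t hst using hends
  let adj : V → V → Prop := fun u v => K.hubEnvelope.Adj u v
  have hsymm : ∀ u v, adj u v → adj v u := fun u v ⟨e, h⟩ => ⟨e, h.symm⟩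
  have hadj : ∀ u v, adj u v → ∃ e, s e = u ∧ t e = v ∨ s e = v ∧ t e = u := by
    rintro u v ⟨e, h⟩
    refine ⟨⟨e, h.edge_mem⟩, ?_⟩
    rcases (hst ⟨e, h.edge_mem⟩).eq_and_eq_or_eq_and_eq h with h | h
    · exact Or.inl ⟨Subtype.ext h.1, Subtype.ext h.2⟩
    · exact Or.inr ⟨Subtype.ext h.1, Subtype.ext h.2⟩
  obtain ⟨P, hP, hPi, hPo⟩ := hK.bipartite
  have hPb : ∀ j, (K.boundary j : K.α) ∈ P := K.boundary_induction (p := fun v => v.1 ∈ P) hPi hPo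
  let C : Finset V := Finset.univ.filter fun v =>
    ∃ x, v = inner x ∧ ∀ i, K.boundary i ≠ x
  let H : Set V := {v | v.1 = none ∨ ∃ i, v.1 = some (.inr i)}
  have hCadj : ∀ u ∈ C, ∀ v, adj u v → ∃ x y, u = inner x ∧ v = inner y ∧
      (∀ i, K.boundary i ≠ x) ∧ K.graph.Adj x y := by
    intro u hu v huv
    obtain ⟨x, rfl, hx⟩ := (Finset.mem_filter.1 hu).2
    obtain ⟨y, hy, hxy⟩ := (K.hubEnvelope_adj_iff (fun i h => hx i (Subtype.ext h)) _).1 huv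
    obtain ⟨e, h⟩ := hxy
    exact ⟨x, ⟨y, h.right_mem⟩, rfl, Subtype.ext hy, hx, e, h⟩
  have hout : ∀ D ⊆ C, ∀ v ∈ outerBoundary adj D, ∃ y, v = inner y := by
    intro D hD v hv
    obtain ⟨-, u, hu, huv⟩ := mem_outerBoundary.1 hv
    obtain ⟨x, y, -, h, -⟩ := hCadj u (hD hu) v huv
    exact ⟨y, h⟩
  have houtC : ∀ v ∈ outerBoundary adj C, ∃ i, v = inner (K.boundary i) := by
    intro v hv
    obtain ⟨y, rfl⟩ := hout C subset_rfl v hv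
    by_contra h
    push Not at h
    exact (mem_outerBoundary.1 hv).1 (Finset.mem_filter.2
      ⟨Finset.mem_univ _, y, rfl, fun i hi => h i (by rw [hi])⟩)
  have hHinner : ∀ x, inner x ∉ H := by
    rintro x (h | ⟨i, h⟩)
    · exact absurd h (by simp [inner])
    · exact absurd h (by simp [inner])
  have hinner : Function.Injective inner := fun x y h =>
    Subtype.ext (Sum.inl.inj (Option.some.inj (Subtype.ext_iff.1 h)))
  have hbound : C.card ≤ (k + l) ^ 2 := by
    rcases C.eq_empty_or_nonempty with h0 | h0
    · rw [h0]; simp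
    have hpatch : IsPatch adj {v | ∃ x ∈ P, v.1 = some (.inl x)} H C := by
      refine ⟨h0, ?_, ?_, ?_, ?_, ?_, ?_, ?_⟩
      · intro p hp
        let o : V := ⟨none, by rintro _ ⟨⟩⟩
        have hpo : ∀ v ∈ H, p v = p o := by
          rintro v (hv | ⟨i, hi⟩)
          · rw [show v = o from Subtype.ext hv]
          · refine hp v (Or.inr ⟨i, hi⟩) o (Or.inl rfl) ⟨.inr i, ?_⟩
            rw [hi]
            exact Sym2.eq_swap
        intro u hu v hv
        rw [hpo u hu, hpo v hv]
      · intro v hv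
        refine ⟨fun h => ?_, fun h => ?_⟩
        · obtain ⟨x, rfl, -⟩ := (Finset.mem_filter.1 h).2
          exact hHinner x hv
        · obtain ⟨y, rfl⟩ := hout C subset_rfl v h
          exact hHinner y hv
      · intro v hv
        obtain ⟨i, rfl⟩ := houtC v hv
        exact ⟨_, hPb i, rfl⟩
      · intro u hu v huv
        obtain ⟨x, y, rfl, rfl, -, e, h⟩ := hCadj u hu v huv
        simpa [inner] using hP e x y h
      · rintro D hD ⟨u, hu⟩
        by_contra hne
        rw [Finset.not_nonempty_iff_eq_empty] at hne
        obtain ⟨x, rfl, -⟩ := (Finset.mem_filter.1 (hD hu)).2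
        -- A set without outer boundary is closed under adjacency, so it would contain a boundary
        -- vertex, which is not inner.
        have key : ∀ y : K.α, Relation.ReflTransGen K.graph.Adj x y →
            ∃ hy : y ∈ K.graph.vertexSet, inner ⟨y, hy⟩ ∈ D := by
          intro y hxy
          induction hxy with
          | refl => exact ⟨x.2, hu⟩
          | tail _ h ih =>
            obtain ⟨hy, hyD⟩ := ih
            obtain ⟨e, h⟩ := h
            refine ⟨h.right_mem, ?_⟩
            by_contra hz
            have : inner ⟨_, h.right_mem⟩ ∈ outerBoundary adj D :=
              mem_outerBoundary.2 ⟨hz, _, hyD, .inl (.inl e), h⟩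
            rw [hne] at this
            exact absurd this (Finset.notMem_empty _)
        obtain ⟨j, hj⟩ := hK.reaches_boundary x.2
        obtain ⟨hy, hyD⟩ := key _ hj
        obtain ⟨z, hz, hzb⟩ := (Finset.mem_filter.1 (hD hyD)).2
        exact hzb j (hinner hz)
      · intro u hu
        obtain ⟨x, rfl, hx⟩ := (Finset.mem_filter.1 hu).2
        have hfin := K.finite_edgeSet.subset (K.graph.incidenceSet_subset_edgeSet x)
        have h4 := hK.four_le_incidenceSet x.2 (fun i h => hx i (Subtype.ext h))
        have hex : ∀ e : K.graph.incidenceSet x, ∃ y : K.graph.vertexSet,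
            K.graph.IsLink e x y := by
          rintro ⟨e, y, h⟩
          exact ⟨⟨y, h.right_mem⟩, h⟩
        choose y hy using hex
        have := hfin.fintype
        rw [← Nat.card_coe_set_eq, Nat.card_eq_fintype_card, ← Finset.card_univ] at h4
        refine h4.trans (Finset.card_le_card_of_injOn (fun e => inner (y e)) ?_ ?_)
        · exact fun e _ => Finset.mem_coe.2 (Finset.mem_filter.2
            ⟨Finset.mem_univ _, .inl (.inl e), hy e⟩)
        · intro e _ f _ hef
          have := hinner hef
          exact Subtype.ext (hK.no_multiple_edges e f x (y e) (hy e) (this ▸ hy f))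
      · intro v hv
        obtain ⟨i, rfl⟩ := houtC v hv
        exact ⟨⟨some (.inr i), by rintro _ ⟨⟩ _ ⟨⟩⟩, Or.inr ⟨i, rfl⟩, .inl (.inr (.inl i)), rfl⟩
    have h1 := (IsPatch.bound (hK.planar.hasDual s t hst) hsymm hadj C _ H hpatch).2
    have h2 : (outerBoundary adj C).card ≤ k + l := by
      refine le_trans (Finset.card_le_card (t := Finset.univ.image fun i => inner (K.boundary i))
        fun v hv => ?_) (Finset.card_image_le.trans (by simp))
      obtain ⟨i, rfl⟩ := houtC v hv
      exact Finset.mem_image_of_mem _ (Finset.mem_univ i)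
    exact h1.trans (Nat.pow_le_pow_left (by omega) 2)
  have hcover : (Finset.univ : Finset K.graph.vertexSet).image inner ⊆
      C ∪ Finset.univ.image fun i => inner (K.boundary i) := by
    intro v hv
    obtain ⟨x, -, rfl⟩ := Finset.mem_image.1 hv
    by_cases hx : ∃ i, K.boundary i = x
    · obtain ⟨i, rfl⟩ := hx
      exact Finset.mem_union_right _ (Finset.mem_image_of_mem _ (Finset.mem_univ i))
    · push Not at hx
      exact Finset.mem_union_left _ (Finset.mem_filter.2 ⟨Finset.mem_univ _, x, rfl, hx⟩)
  rw [Nat.card_eq_fintype_card, ← Finset.card_univ, ← Finset.card_image_of_injective _ hinner]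
  refine (Finset.card_le_card hcover).trans ((Finset.card_union_le _ _).trans
    (add_le_add hbound (Finset.card_image_le.trans (by simp))))

/-! ### Finitely many isomorphism classes -/

/-- Without multiple edges an edge is determined by its ends, so a bijection of vertices that
respects adjacency induces one of edges. -/
theorem isomorphic_of_adj_iff {K K' : BilabelledGraph k l}
    (hK : ∀ e f x y, K.graph.IsLink e x y → K.graph.IsLink f x y → e = f)
    (hK' : ∀ e f x y, K'.graph.IsLink e x y → K'.graph.IsLink f x y → e = f)
    (f : K.graph.vertexSet ≃ K'.graph.vertexSet)
    (hf : ∀ x y : K.graph.vertexSet, K.graph.Adj x y ↔ K'.graph.Adj (f x) (f y))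
    (hi : ∀ i, f (K.input i) = K'.input i) (ho : ∀ i, f (K.output i) = K'.output i) :
    Isomorphic K K' := by
  have hends : ∀ e : K.graph.edgeSet, ∃ x y : K.graph.vertexSet, K.graph.IsLink e x y := by
    intro e
    obtain ⟨x, y, h⟩ := Graph.exists_isLink_of_mem_edgeSet e.2
    exact ⟨⟨x, h.left_mem⟩, ⟨y, h.right_mem⟩, h⟩
  have hex : ∀ e : K.graph.edgeSet, ∃ e' : K'.graph.edgeSet, ∀ x y : K.graph.vertexSet,
      K.graph.IsLink e x y ↔ K'.graph.IsLink e' (f x) (f y) := by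
    intro e
    obtain ⟨x, y, h⟩ := hends e
    obtain ⟨e', h'⟩ := (hf x y).1 ⟨e, h⟩
    refine ⟨⟨e', h'.edge_mem⟩, fun x' y' => ?_⟩
    rw [h.isLink_iff, h'.isLink_iff]
    simp only [Subtype.coe_inj, f.injective.eq_iff]
  choose g hg using hex
  refine ⟨f, Equiv.ofBijective g ⟨fun e e' h => ?_, fun e' => ?_⟩, fun e x y => hg e x y, hi, ho⟩
  · obtain ⟨x, y, hxy⟩ := hends e
    refine Subtype.ext (hK e e' x y hxy ?_)
    rw [hg, ← h, ← hg]
    exact hxy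
  · obtain ⟨x, y, h⟩ := Graph.exists_isLink_of_mem_edgeSet e'.2
    obtain ⟨x, rfl⟩ : ∃ z, (f z : K'.α) = x := ⟨f.symm ⟨x, h.left_mem⟩, by simp⟩
    obtain ⟨y, rfl⟩ : ∃ z, (f z : K'.α) = y := ⟨f.symm ⟨y, h.right_mem⟩, by simp⟩
    obtain ⟨e, he⟩ := (hf x y).2 ⟨e', h⟩
    exact ⟨⟨e, he.edge_mem⟩, Subtype.ext (hK' _ _ _ _ ((hg ⟨e, he.edge_mem⟩ x y).1 he) h)⟩

/-- A numbering of the vertices for which adjacency and the two tuples are as prescribed. -/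
def HasCode (K : BilabelledGraph k l) (m : ℕ)
    (c : (Fin m → Fin m → Prop) × (Fin k → Fin m) × (Fin l → Fin m)) : Prop :=
  ∃ f : K.graph.vertexSet ≃ Fin m, (∀ x y : K.graph.vertexSet, K.graph.Adj x y ↔ c.1 (f x) (f y)) ∧
    (∀ i, f (K.input i) = c.2.1 i) ∧ ∀ i, f (K.output i) = c.2.2 i

theorem exists_hasCode (K : BilabelledGraph k l) :
    ∃ c, K.HasCode (Nat.card K.graph.vertexSet) c := by
  have := K.finite_vertexSet.to_subtype
  let f := Finite.equivFin K.graph.vertexSet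
  exact ⟨(fun i j => K.graph.Adj (f.symm i) (f.symm j), fun i => f (K.input i),
    fun i => f (K.output i)), f,
    fun x y => by simp only [Equiv.symm_apply_apply], fun _ => rfl, fun _ => rfl⟩

end BilabelledGraph

open BilabelledGraph in
theorem theorem4 (k l : ℕ) : (BilabelledGraph.C k l).Finite := by
  have hfin : (⋃ (m : Fin ((k + l) ^ 2 + (k + l) + 1))
      (c : (Fin m → Fin m → Prop) × (Fin k → Fin m) × (Fin l → Fin m)),
      {q | ∃ K : BilabelledGraph k l, K.IsReduced ∧ K.HasCode m c ∧
        Quotient.mk (isoSetoid k l) K = q}).Finite := by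
    -- There are finitely many codes, and a code determines a reduced graph up to isomorphism.
    refine Set.finite_iUnion fun m => Set.finite_iUnion fun c => Set.Subsingleton.finite ?_
    rintro _ ⟨K, hK, ⟨f, hf, hfi, hfo⟩, rfl⟩ _ ⟨K', hK', ⟨f', hf', hfi', hfo'⟩, rfl⟩
    refine Quotient.sound (isomorphic_of_adj_iff hK.no_multiple_edges hK'.no_multiple_edges
      (f.trans f'.symm) (fun x y => ?_) (fun i => ?_) (fun i => ?_))
    · rw [hf, hf']; simp
    · simp [hfi, ← hfi']
    · simp [hfo, ← hfo']
  refine hfin.subset ?_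
  rintro _ ⟨K, hK, rfl⟩
  obtain ⟨c, hc⟩ := K.exists_hasCode
  exact Set.mem_iUnion.2 ⟨⟨_, Nat.lt_succ_of_le hK.ncard_vertexSet_le⟩,
    Set.mem_iUnion.2 ⟨c, K, hK, hc, rfl⟩⟩
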